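/- **Definitions.** A *round counter* is a function $\bar r:\mathbb Z_{\ge 0}\to\mathbb Z_{\ge 0}\cup\{\bot\}$ whose support $\operatorname{supp}\bar r=\{i:\bar r(i)\ne\bot\}$ is finite. A *witness prestructure* is a sequence $\sigma=((W_0,G_0),\dots,(W_t,G_t))$, $t\ge 0$, of pairs of finite subsets of $\mathbb Z_{\ge 0}$ with $W_i,G_i\subseteq W_0$ for $i\ge 1$, $G_i\cap G_j=\emptyset$ for $i<j$, and $G_i\cap W_j=\emptyset$ for $i\le j$; it is a *witness structure* if $W_1,\dots,W_t$ are nonempty. Put $\operatorname{supp}\sigma=W_0\cup G_0$, $G(\sigma)=\bigcup_i G_i$, $A(\sigma)=\operatorname{supp}\sigma\setminus G(\sigma)$, $R_i=W_i\cup G_i$, $\operatorname{Tr}(p)=\{i: p\in R_i\}$ and $M(p,\sigma)=|\operatorname{Tr}(p)|$. For $S\subseteq A(\sigma)$ let $q$ be the largest $i\le t$ with $R_i\not\subseteq S\cup G(\sigma)$ ($q=0$ if there is none). The *stabilization* $\mathrm{st}_S(\sigma)=((W'_0,G'_0),\dots,(W'_q,G'_q))$ is obtained by truncating all traces to $\{0,\dots,q\}$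 and taking $G(\sigma)\cup S$ as the new ghost set: $G'_i$ is the set of all $p\in G(\sigma)\cup S$ for which $i$ is the largest element of $\operatorname{Tr}(p)\cap\{0,\dots,q\}$, and $W'_i=R_i\setminus G'_i$. The *canonical form* of $((W_0,G_0),\dots,(W_t,G_t))$, where $W_t\neq\emptyset$ if $t\ge1$, is $((W_0,G_0),(W_{i_1},\widetilde G_1),\dots,(W_{i_m},\widetilde G_m))$, where $i_1<\dots<i_m$ are the indices $i\ge 1$ with $W_i\ne\emptyset$, $i_0=0$, and $\widetilde G_k=\bigcup_{i_{k-1}<i\le i_k}G_i$. The *ghosting* $\Gamma_S(\sigma)$ is the canonical form of $\mathrm{st}_S(\sigma)$. The *immediate snapshot complex* $P(\bar r)$ has its simplices indexed by the witness structures $\sigma$ with $\operatorname{supp}\sigma=\operatorname{supp}\bar r$, $M(p,\sigma)=\bar r(p)+1$ for $p\in A(\sigma)$, and $M(p,\sigma)\le\bar r(p)+1$ for $p\in G(\sigma)$; the simplex indexed by $\sigma$ has the vertices $\Gamma_{A(\sigma)\setminus\{a\}}(\sigma)$, $a\in A(\sigma)$. The empty simplex, of dimension $-1$, counts as a simplex.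 For $p\in\operatorname{supp}\bar r$, $B_p(\bar r)$ is the subcomplex of the simplices with $p\in G_0$. For a pseudomanifold $K$ of dimension $n$, the boundary $\partial K$ is the subcomplex formed by the $(n-1)$-simplices that are faces of exactly one $n$-simplex, together with all their faces, and $\operatorname{int}K$ consists of the simplices of $K$ not in $\partial K$. A pair $(\sigma,\tau)$ of simplices of $K$ is an *elementary collapse* if $\tau$ is a maximal simplex and is the only simplex properly containing $\sigma$; performing it removes $\sigma$ and $\tau$ from $K$. A finite complex is *collapsible* if some sequence of elementary collapses, each in what the previous ones have left, matches up and removes all of its simplices (the empty one included). **Theorem.** Let $\bar r$ be a round counter. 1. $P(\bar r)$ is a well-defined simplicial complex: every subset of the vertex set of a simplex is the vertex set of a simplex, distinct witness structures index simplices with distinct vertex sets, and the simplex indexed by $\sigma$ has exactly $|A(\sigma)|$ vertices. 2. If $\operatorname{supp}\bar r\neq\emptyset$, then $P(\bar r)$ is collapsible. 3. For every $p\in\operatorname{supp}\bar r$ there is a sequence of elementary collapses that reduces $P(\bar r)$ to $\partial P(\bar r)\setminus\operatorname{int}B_p(\bar r)$. -/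

import Mathlib

open Finset

namespace ImmediateSnapshot

/-! ### Simplicial complexes and collapses

A simplicial complex is given by its set of simplices, each being the finite set of its vertices.
The empty simplex, of dimension `-1`, counts as a simplex, so a nonempty family `K` is a
simplicial complex exactly when it is a lower set for inclusion. -/

section Collapse

variable {α : Type*}

/-- `(σ, τ)` is an elementary collapse in `K`: `τ` is a maximal simplex of `K`, and `τ` is the only
simplex of `K` that properly contains the simplex `σ`. -/
def IsElementaryCollapse (K : Set (Finset α)) (σ τ : Finset α) : Prop :=
  σ ∈ K ∧ Maximal (fun ρ => ρ ∈ K) τ ∧ ∀ ρ ∈ K, σ ⊂ ρ ↔ ρ = τ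

/-- Some finite sequence of elementary collapses, each of them performed in what the previous ones
have left, reduces `K` to `L`. -/
def CollapsesTo (K L : Set (Finset α)) : Prop :=
  Relation.ReflTransGen
    (fun M N => ∃ σ τ, IsElementaryCollapse M σ τ ∧ N = M \ {σ, τ}) K L

/-- A finite complex is collapsible if a sequence of elementary collapses matches up (and removes)
all of its simplices, the empty simplex included. (The empty simplex is necessarily matched with
the last remaining vertex, so that this is the usual collapsibility to a point.) -/
def Collapsible (K : Set (Finset α)) : Prop :=
  K.Finite ∧ CollapsesTo K ∅

/-- `ρ` is a simplex of `K` of the largest dimension. -/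
def IsTopSimplex (K : Set (Finset α)) (ρ : Finset α) : Prop :=
  ρ ∈ K ∧ ∀ ρ' ∈ K, ρ'.card ≤ ρ.card

/-- The boundary of an `n`-dimensional pseudomanifold `K`: the subcomplex formed by the
`(n-1)`-simplices that are faces of precisely one `n`-simplex, and by their faces. -/
def boundary (K : Set (Finset α)) : Set (Finset α) :=
  {σ | ∃ τ ∈ K, σ ⊆ τ ∧ ∃! ρ, IsTopSimplex K ρ ∧ τ ⊆ ρ ∧ τ.card + 1 = ρ.card}

/-- The simplices (identified with their open simplices) that make up the interior of `K`. -/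
def interior (K : Set (Finset α)) : Set (Finset α) :=
  K \ boundary K

end Collapse

/-! ### Round counters -/

/-- A round counter: a function `ℕ → ℕ ∪ {⊥}` with finite support set. -/
structure RoundCounter where
  toFun : ℕ → WithBot ℕ
  finite_support : {i | toFun i ≠ ⊥}.Finite

/-- The support set of a round counter. -/
noncomputable def RoundCounter.supp (r : RoundCounter) : Finset ℕ :=
  r.finite_support.toFinset

/-! ### Witness structures -/

/-- A witness prestructure `((W 0, G 0), …, (W t, G t))`. The two sequences of finite sets are
continued by `∅` beyond the index `t`. -/
@[ext]
structure WitnessPrestructure where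
  t : ℕ
  W : ℕ → Finset ℕ
  G : ℕ → Finset ℕ
  W_of_lt : ∀ i, t < i → W i = ∅
  G_of_lt : ∀ i, t < i → G i = ∅
  W_subset : ∀ i, 1 ≤ i → W i ⊆ W 0
  G_subset : ∀ i, 1 ≤ i → G i ⊆ W 0
  G_disjoint : ∀ i j, i < j → Disjoint (G i) (G j)
  G_disjoint_W : ∀ i j, i ≤ j → Disjoint (G i) (W j)

namespace WitnessPrestructure

/-- A witness structure is a witness prestructure with `W 1, …, W t` all nonempty. -/
def IsWitnessStructure (σ : WitnessPrestructure) : Prop :=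
  ∀ i, 1 ≤ i → i ≤ σ.t → (σ.W i).Nonempty

/-- The support `W 0 ∪ G 0`. -/
def supp (σ : WitnessPrestructure) : Finset ℕ := σ.W 0 ∪ σ.G 0

/-- The ghost set `G 0 ∪ … ∪ G t`. -/
def ghosts (σ : WitnessPrestructure) : Finset ℕ := (range (σ.t + 1)).biUnion σ.G

/-- The active set. -/
def active (σ : WitnessPrestructure) : Finset ℕ := σ.supp \ σ.ghosts

/-- `R i = W i ∪ G i`. -/
def R (σ : WitnessPrestructure) (i : ℕ) : Finset ℕ := σ.W i ∪ σ.G i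

/-- The trace of `p`. -/
def trace (σ : WitnessPrestructure) (p : ℕ) : Finset ℕ :=
  (range (σ.t + 1)).filter (fun i => p ∈ σ.R i)

/-- `M(p, σ)`, the cardinality of the trace of `p`. -/
def M (σ : WitnessPrestructure) (p : ℕ) : ℕ := (σ.trace p).card

lemma R_subset (σ : WitnessPrestructure) (i : ℕ) (hi : 1 ≤ i) : σ.R i ⊆ σ.W 0 :=
  Finset.union_subset (σ.W_subset i hi) (σ.G_subset i hi)

/-- The index at which traces are truncated when `σ` is stabilized with respect to `S`: the largest
`i ≤ t` with `R i ⊄ S ∪ G(σ)` (and `0` if there is none). -/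
def stabIndex (σ : WitnessPrestructure) (S : Finset ℕ) : ℕ :=
  ((range (σ.t + 1)).filter (fun i => ¬ σ.R i ⊆ S ∪ σ.ghosts)).sup id

/-- The `i`-th ghost column of the stabilization: the `p ∈ S ∪ G(σ)` such that `i` is the largest
element of the truncated trace of `p`. -/
def stabG (σ : WitnessPrestructure) (S : Finset ℕ) (i : ℕ) : Finset ℕ :=
  if i ≤ σ.stabIndex S then
    (σ.R i).filter (fun p => p ∈ S ∪ σ.ghosts ∧ ∀ j ∈ Ioc i (σ.stabIndex S), p ∉ σ.R j)
  else ∅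

/-- The `i`-th upper column of the stabilization: the `p` such that `i` lies in the truncated trace
of `p`, without those in the `i`-th ghost column. -/
def stabW (σ : WitnessPrestructure) (S : Finset ℕ) (i : ℕ) : Finset ℕ :=
  if i ≤ σ.stabIndex S then σ.R i \ σ.stabG S i else ∅

lemma mem_stabG {σ : WitnessPrestructure} {S : Finset ℕ} {i p : ℕ} :
    p ∈ σ.stabG S i ↔ i ≤ σ.stabIndex S ∧ p ∈ σ.R i ∧ p ∈ S ∪ σ.ghosts ∧
      ∀ j, i < j → j ≤ σ.stabIndex S → p ∉ σ.R j := by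
  unfold stabG
  split_ifs with h
  · simp [h]
  · simp [h]

lemma mem_stabW {σ : WitnessPrestructure} {S : Finset ℕ} {i p : ℕ} :
    p ∈ σ.stabW S i ↔ i ≤ σ.stabIndex S ∧ p ∈ σ.R i ∧ p ∉ σ.stabG S i := by
  unfold stabW
  split_ifs with h
  · simp [h]
  · simp [h]

/-- The stabilization `st_S(σ)`: the witness prestructure with active set `A(σ) \ S`, ghost set
`G(σ) ∪ S`, and the traces of `σ` truncated at `stabIndex`. -/
def stabilize (σ : WitnessPrestructure) (S : Finset ℕ) : WitnessPrestructure where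
  t := σ.stabIndex S
  W := σ.stabW S
  G := σ.stabG S
  W_of_lt i hi := by simp [stabW, Nat.not_le.mpr hi]
  G_of_lt i hi := by simp [stabG, Nat.not_le.mpr hi]
  W_subset i hi p hp := by
    rw [mem_stabW] at hp ⊢
    refine ⟨Nat.zero_le _, Finset.mem_union_left _ (σ.R_subset i hi hp.2.1), fun h => ?_⟩
    exact (mem_stabG.mp h).2.2.2 i hi hp.1 hp.2.1
  G_subset i hi p hp := by
    rw [mem_stabG] at hp
    rw [mem_stabW]
    refine ⟨Nat.zero_le _, Finset.mem_union_left _ (σ.R_subset i hi hp.2.1), fun h => ?_⟩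
    exact (mem_stabG.mp h).2.2.2 i hi hp.1 hp.2.1
  G_disjoint i j hij := Finset.disjoint_left.mpr fun p hi hj =>
    (mem_stabG.mp hi).2.2.2 j hij (mem_stabG.mp hj).1 (mem_stabG.mp hj).2.1
  G_disjoint_W i j hij := Finset.disjoint_left.mpr fun p hi hj => by
    rcases hij.eq_or_lt with rfl | hlt
    · exact (mem_stabW.mp hj).2.2 hi
    · exact (mem_stabG.mp hi).2.2.2 j hlt (mem_stabW.mp hj).1 (mem_stabW.mp hj).2.1

/-- The indices `1 ≤ i ≤ t` with `W i ≠ ∅`, namely `i_1 < … < i_q` in the canonical form. -/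
def steps (σ : WitnessPrestructure) : Finset ℕ :=
  (Icc 1 σ.t).filter (fun i => (σ.W i).Nonempty)

/-- The column of the canonical form into which column `i` is merged: `0` for `i = 0`, and the `k`
with `i_{k-1} < i ≤ i_k` for `i ≥ 1`, where `i_0 = 0`. -/
def slot (σ : WitnessPrestructure) (i : ℕ) : ℕ :=
  if i = 0 then 0 else (σ.steps.filter (fun j => j < i)).card + 1

/-- Column `k ≤ q` of the canonical form, for either of the sequences `F = W` and `F = G`:
the union of the `F i` over all `i ≤ t` that are merged into `k`. In the case `F = W` and `k ≥ 1`,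
the only nonempty member of that union is `W i_k`. -/
def mergeColumn (σ : WitnessPrestructure) (F : ℕ → Finset ℕ) (k : ℕ) : Finset ℕ :=
  if k ≤ σ.steps.card then ((range (σ.t + 1)).filter (fun i => σ.slot i = k)).biUnion F else ∅

lemma mem_mergeColumn {σ : WitnessPrestructure} {F : ℕ → Finset ℕ} {k p : ℕ} :
    p ∈ σ.mergeColumn F k ↔
      k ≤ σ.steps.card ∧ ∃ i, i ≤ σ.t ∧ σ.slot i = k ∧ p ∈ F i := by
  unfold mergeColumn
  split_ifs with h
  · simp [h, and_assoc]
  · simp [h]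

lemma slot_eq_zero {σ : WitnessPrestructure} {i : ℕ} : σ.slot i = 0 ↔ i = 0 := by
  unfold slot
  split_ifs with h <;> simp [h]

lemma slot_lt_slot {σ : WitnessPrestructure} {i j p : ℕ} (hji : j < i) (hp : p ∈ σ.W j)
    (hj : j ≤ σ.t) : σ.slot j < σ.slot i := by
  have hi : i ≠ 0 := by omega
  by_cases h0 : j = 0
  · simp [slot, h0, hi]
  · simp only [slot, h0, hi, if_false]
    refine Nat.succ_lt_succ (Finset.card_lt_card ?_)
    have hmem : j ∈ σ.steps :=
      Finset.mem_filter.mpr ⟨Finset.mem_Icc.mpr ⟨Nat.one_le_iff_ne_zero.mpr h0, hj⟩, ⟨p, hp⟩⟩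
    refine (Finset.ssubset_iff_of_subset fun k hk => ?_).mpr
      ⟨j, Finset.mem_filter.mpr ⟨hmem, hji⟩, by simp⟩
    rw [Finset.mem_filter] at hk ⊢
    exact ⟨hk.1, hk.2.trans hji⟩

lemma mem_mergeColumn_W_zero {σ : WitnessPrestructure} {p : ℕ} (hp : p ∈ σ.W 0) :
    p ∈ σ.mergeColumn σ.W 0 :=
  mem_mergeColumn.mpr ⟨Nat.zero_le _, 0, Nat.zero_le _, slot_eq_zero.mpr rfl, hp⟩

/-- The canonical form `C(σ)` of a stable witness prestructure: empty steps are removed, their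
ghosts being merged into the next nonempty step. -/
def canonicalForm (σ : WitnessPrestructure) : WitnessPrestructure where
  t := σ.steps.card
  W := σ.mergeColumn σ.W
  G := σ.mergeColumn σ.G
  W_of_lt i hi := by simp [mergeColumn, Nat.not_le.mpr hi]
  G_of_lt i hi := by simp [mergeColumn, Nat.not_le.mpr hi]
  W_subset k hk p hp := by
    obtain ⟨-, i, -, hs, hpi⟩ := mem_mergeColumn.mp hp
    have : i ≠ 0 := fun h => by rw [slot_eq_zero.mpr h] at hs; omega
    exact mem_mergeColumn_W_zero (σ.W_subset i (Nat.one_le_iff_ne_zero.mpr this) hpi)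
  G_subset k hk p hp := by
    obtain ⟨-, i, -, hs, hpi⟩ := mem_mergeColumn.mp hp
    have : i ≠ 0 := fun h => by rw [slot_eq_zero.mpr h] at hs; omega
    exact mem_mergeColumn_W_zero (σ.G_subset i (Nat.one_le_iff_ne_zero.mpr this) hpi)
  G_disjoint k l hkl := Finset.disjoint_left.mpr fun p hk hl => by
    obtain ⟨-, i, -, hi, hpi⟩ := mem_mergeColumn.mp hk
    obtain ⟨-, j, -, hj, hpj⟩ := mem_mergeColumn.mp hl
    rcases lt_trichotomy i j with h | h | h
    · exact Finset.disjoint_left.mp (σ.G_disjoint i j h) hpi hpj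
    · subst h; omega
    · exact Finset.disjoint_left.mp (σ.G_disjoint j i h) hpj hpi
  G_disjoint_W k l hkl := Finset.disjoint_left.mpr fun p hk hl => by
    obtain ⟨-, i, -, hi, hpi⟩ := mem_mergeColumn.mp hk
    obtain ⟨-, j, hjt, hj, hpj⟩ := mem_mergeColumn.mp hl
    rcases le_or_gt i j with h | h
    · exact Finset.disjoint_left.mp (σ.G_disjoint_W i j h) hpi hpj
    · have := slot_lt_slot h hpj hjt
      omega

/-- The ghosting operation `Γ_S(σ) = C(st_S(σ))`. -/
def ghost (S : Finset ℕ) (σ : WitnessPrestructure) : WitnessPrestructure :=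
  (σ.stabilize S).canonicalForm

open Classical in
/-- The set `V(σ)` of vertices `Γ_{A(σ) \ {a}}(σ)`, `a ∈ A(σ)`, of the simplex indexed by `σ`. -/
noncomputable def vertices (σ : WitnessPrestructure) : Finset WitnessPrestructure :=
  σ.active.image (fun a => ghost (σ.active \ {a}) σ)

end WitnessPrestructure

/-! ### Immediate snapshot complexes -/

/-- The witness structures that index the simplices of the immediate snapshot complex `P(r)`. -/
def simplexIndices (r : RoundCounter) : Set WitnessPrestructure :=
  {σ | σ.IsWitnessStructure ∧ σ.supp = r.supp ∧
    (∀ p ∈ σ.active, ((σ.M p : ℕ) : WithBot ℕ) = r.toFun p + 1) ∧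
    (∀ p ∈ σ.ghosts, ((σ.M p : ℕ) : WithBot ℕ) ≤ r.toFun p + 1)}

/-- The immediate snapshot complex `P(r)`, given by its simplices. -/
def complex (r : RoundCounter) : Set (Finset WitnessPrestructure) :=
  WitnessPrestructure.vertices '' simplexIndices r

/-- The subcomplex `B_V(r)` of `P(r)` of all simplices whose witness structure has `V ⊆ G 0`. -/
def boundaryPart (r : RoundCounter) (V : Finset ℕ) : Set (Finset WitnessPrestructure) :=
  WitnessPrestructure.vertices '' {σ ∈ simplexIndices r | V ⊆ σ.G 0}

end ImmediateSnapshot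

/-! A witness structure with support `U` is recovered from its list of rounds `[R 1, …, R t]` and
its ghost set `D`: `G i` consists of the ghosts whose last occurrence is in `R i`. That all `W i`
with `1 ≤ i ≤ t` are nonempty means that no round consists of last occurrences of ghosts only
(`IsNormal`). Ghosting becomes `norm`, a recursion from the last round backwards: a round all of
whose members are ghosts without later occurrence is merged into the next round, or dropped if none
is left (`encode_ghost`).

For part 1, ghosting in two stages is ghosting at once (`norm_norm`), and a normal list is
determined by the lists of its vertices (`IsNormal.ext`): its first round is the smallest first
round among the vertices that have one, and once it is known it can be cancelled. So inclusion of
vertex sets is the face relation `FaceLE` (`vertices_subset_iff`).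

Parts 2 and 3 both rest on `erasable_configs`: for `p ∈ U` and any `V`, the simplices with `G 0 \
{p} = V` can be matched and removed. Since `G 0` can only grow on passing to a face, these blocks
may be removed in order of increasing `|V|`, which leaves nothing and proves part 2. For part 3,
counting top-dimensional cofaces (`boundary_image_configs`) shows that the boundary of `P(r)` is
given by `G 0 ≠ ∅` and the interior of `B_p` by `G 0 = {p}`. What part 3 has to remove is therefore
the single block `V = ∅`.

`erasable_configs` is an induction on the total number of rounds. If `p` executes no round, each
simplex is matched with the one in which the ghost status of `p` is switched. Otherwise let `N` be
the image of prepending the round `{p}`. It is closed under faces, and its part of the block is a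
copy of a block with one round less. The rest is sorted by first round `S`; cancelling `S` turns
each class into a union of blocks for smaller round numbers, with apex `p` if `p ∉ S`, and with
another apex `q ∈ S` if `p ∈ S`. -/

namespace ImmediateSnapshot

/-! ### Sets of simplices that can be removed by collapses -/

section Erasable

variable {α β : Type*}

/-- `Q` can be exhausted by repeatedly removing pairs `σ, τ` such that `τ` is the only element
of what is left, apart from `σ` itself, that lies above `σ`. -/
inductive Erasable (le : α → α → Prop) : Set α → Prop
  | empty : Erasable le ∅
  | step {Q : Set α} {σ τ : α} (hσ : σ ∈ Q) (hτ : τ ∈ Q) (hne : σ ≠ τ)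
      (hle : ∀ ρ ∈ Q, le σ ρ ↔ ρ = σ ∨ ρ = τ) (h : Erasable le (Q \ {σ, τ})) : Erasable le Q

theorem Erasable.pair {le : α → α → Prop} {σ τ : α} (hne : σ ≠ τ) (h1 : le σ σ) (h2 : le σ τ) :
    Erasable le {σ, τ} := by
  refine .step (σ := σ) (τ := τ) (by simp) (by simp) hne ?_ (by simpa using Erasable.empty)
  rintro ρ (rfl | rfl)
  · simp [h1]
  · simp [h2]

/-- As nothing in `D` lies above an element of `U`, the pairs of `U` stay removable in the presence
of `D`, so `U` goes first. -/
theorem Erasable.union {le : α → α → Prop} {U D : Set α} (hU : Erasable le U)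
    (hD : Erasable le D) (hdis : Disjoint U D) (h : ∀ u ∈ U, ∀ d ∈ D, ¬ le u d) :
    Erasable le (U ∪ D) := by
  induction hU with
  | empty => simpa using hD
  | @step Q σ τ hσ hτ hne hle _ ih =>
    have hσD : σ ∉ D := Set.disjoint_left.mp hdis hσ
    have hτD : τ ∉ D := Set.disjoint_left.mp hdis hτ
    refine .step (Or.inl hσ) (Or.inl hτ) hne ?_ ?_
    · rintro ρ (hρ | hρ)
      · exact hle ρ hρ
      · refine iff_of_false (h σ hσ ρ hρ) ?_
        rintro (rfl | rfl) <;> contradiction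
    · have : (Q ∪ D) \ {σ, τ} = Q \ {σ, τ} ∪ D := by
        rw [Set.union_sdiff_distrib]
        congr 1
        refine sdiff_eq_left.mpr (Set.disjoint_right.mpr ?_)
        rintro x (rfl | rfl) <;> assumption
      rw [this]
      exact ih (hdis.mono_left Set.sdiff_subset) fun u hu => h u hu.1

/-- The patchwork principle: matchings of the fibres of a map whose rank strictly increases along
comparisons between different fibres fit together. Fibres are removed from the highest rank down. -/
theorem Erasable.of_fibers {le : α → α → Prop} {Q : Set α} (hQ : Q.Finite) (f : α → β)
    (rank : β → ℤ)
    (h : ∀ x ∈ Q, ∀ y ∈ Q, le x y → f x = f y ∨ rank (f x) < rank (f y))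
    (hf : ∀ b, Erasable le {x ∈ Q | f x = b}) : Erasable le Q := by
  induction hn : Q.ncard using Nat.strong_induction_on generalizing Q with
  | _ n ih =>
    rcases Q.eq_empty_or_nonempty with rfl | hne
    · exact .empty
    obtain ⟨x0, hx0, hmax⟩ := Set.exists_max_image Q (fun x => rank (f x)) hQ hne
    have hsplit : Q = {x ∈ Q | f x = f x0} ∪ {x ∈ Q | f x ≠ f x0} := by
      ext x; by_cases hx : f x = f x0 <;> simp [hx]
    rw [hsplit]
    refine (hf (f x0)).union ?_ ?_ ?_
    · refine ih _ ?_ (hQ.subset (Set.sep_subset _ _)) (fun x hx y hy => h x hx.1 y hy.1) ?_ rfl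
      · rw [← hn]
        exact Set.ncard_lt_ncard ⟨Set.sep_subset _ _, fun hs => (hs hx0).2 rfl⟩ hQ
      · intro b
        by_cases hb : b = f x0
        · convert Erasable.empty
          ext x; simp only [Set.mem_ofPred_eq, Set.mem_empty_iff_false, iff_false]
          rintro ⟨⟨-, h1⟩, h2⟩
          exact h1 (h2.trans hb)
        · convert hf b using 1
          ext x; simp only [Set.mem_ofPred_eq]
          constructor
          · rintro ⟨⟨h1, -⟩, h2⟩; exact ⟨h1, h2⟩
          · rintro ⟨h1, h2⟩; exact ⟨⟨h1, fun h3 => hb (h2.symm.trans h3)⟩, h2⟩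
    · exact Set.disjoint_left.mpr fun x h1 h2 => h2.2 h1.2
    · rintro u ⟨hu, hu'⟩ d ⟨hd, hd'⟩ hle
      rcases h u hu d hd hle with h1 | h1
      · exact hd' (h1.symm.trans hu')
      · have := hmax d hd
        -- A relation leaving the fibre of `x0` would lead to a rank above the maximal one.
        rw [hu'] at h1
        omega

theorem Erasable.image {le : α → α → Prop} {le' : β → β → Prop} {Q : Set α} (hQ : Erasable le Q)
    (f : α → β) (hinj : Set.InjOn f Q)
    (h : ∀ x ∈ Q, ∀ y ∈ Q, le x y ↔ le' (f x) (f y)) : Erasable le' (f '' Q) := by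
  induction hQ with
  | empty => simpa using Erasable.empty
  | @step Q σ τ hσ hτ hne hle _ ih =>
    refine .step (Set.mem_image_of_mem f hσ) (Set.mem_image_of_mem f hτ)
      (fun he => hne (hinj hσ hτ he)) ?_ ?_
    · rintro _ ⟨ρ, hρ, rfl⟩
      rw [← h σ hσ ρ hρ, hle ρ hρ, hinj.eq_iff hρ hσ, hinj.eq_iff hρ hτ]
    · have : f '' Q \ {f σ, f τ} = f '' (Q \ {σ, τ}) := by
        rw [hinj.image_sdiff_subset, Set.image_pair]
        rintro x (rfl | rfl) <;> assumption
      rw [this]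
      exact ih (hinj.mono Set.sdiff_subset) fun x hx y hy => h x hx.1 y hy.1

/-- Since `Q` is closed under cofaces in `K`, a pair that is free in `Q` is free in all of `K`. -/
theorem Erasable.collapsesTo {Q : Set (Finset α)} (hQ : Erasable (· ⊆ ·) Q) {K : Set (Finset α)}
    (hQK : Q ⊆ K) (hup : ∀ σ ∈ Q, ∀ ρ ∈ K, σ ⊆ ρ → ρ ∈ Q) : CollapsesTo K (K \ Q) := by
  induction hQ generalizing K with
  | empty => rw [Set.sdiff_empty]; exact Relation.ReflTransGen.refl
  | @step Q σ τ hσ hτ hne hle _ ih =>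
    have hστ : σ ⊂ τ := lt_of_le_of_ne ((hle τ hτ).mpr (Or.inr rfl)) hne
    have key : ∀ ρ ∈ K, σ ⊂ ρ ↔ ρ = τ := fun ρ hρ => by
      constructor
      · intro h
        rcases (hle ρ (hup σ hσ ρ hρ h.1)).mp h.1 with h' | h'
        · exact absurd h' h.ne'
        · exact h'
      · rintro rfl; exact hστ
    have hK : (K \ {σ, τ}) \ (Q \ {σ, τ}) = K \ Q := by
      ext x
      simp only [Set.mem_sdiff, Set.mem_insert_iff, Set.mem_singleton_iff]
      constructor
      · rintro ⟨⟨h1, h2⟩, h3⟩; exact ⟨h1, fun h => h3 ⟨h, h2⟩⟩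
      · rintro ⟨h1, h2⟩
        refine ⟨⟨h1, ?_⟩, fun h => h2 h.1⟩
        rintro (rfl | rfl) <;> contradiction
    have := ih (K := K \ {σ, τ}) (Set.sdiff_subset_sdiff_left hQK)
      (fun σ' h' ρ hρ hs => ⟨hup σ' h'.1 ρ hρ.1 hs, hρ.2⟩)
    rw [hK] at this
    refine Relation.ReflTransGen.head ⟨σ, τ, ⟨hQK hσ, ⟨hQK hτ, ?_⟩, key⟩, rfl⟩ this
    -- A simplex above `τ` properly contains `σ`, so it is `τ`; this is the maximality of `τ`.
    intro ρ hρ hs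
    exact ((key ρ hρ).mp (lt_of_lt_of_le hστ hs)).le

end Erasable

end ImmediateSnapshot

namespace ImmediateSnapshot

/-! ### Lists of rounds

A witness structure with support `U` is encoded by the list `L = [R 1, …, R t]` and by its ghost
set `D`. -/

/-- The set of all processes that occur in a list of rounds. -/
def unionOf : List (Finset ℕ) → Finset ℕ
  | [] => ∅
  | S :: L => S ∪ unionOf L

/-- Merge `S` into the first round of a list, if there is one. -/
def mergeHead (S : Finset ℕ) : List (Finset ℕ) → List (Finset ℕ)
  | [] => []
  | T :: L => (S ∪ T) :: L

/-- Put the round `S` in front of `L`; if all its elements are ghosts that do not occur in `L`,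
it is merged into the next round. -/
def push (D S : Finset ℕ) (L : List (Finset ℕ)) : List (Finset ℕ) :=
  if S ⊆ D \ unionOf L then mergeHead S L else S :: L

/-- The list of rounds after ghosting the elements of `D`. -/
def norm (D : Finset ℕ) : List (Finset ℕ) → List (Finset ℕ)
  | [] => []
  | S :: L => push D S (norm D L)

/-- With ghost set `D`, no round of the list consists of last occurrences of ghosts only. -/
def IsNormal (D : Finset ℕ) : List (Finset ℕ) → Prop
  | [] => True
  | S :: L => ¬ S ⊆ D \ unionOf L ∧ IsNormal D L

/-- The number of rounds in which `a` occurs. -/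
def occ (a : ℕ) : List (Finset ℕ) → ℕ
  | [] => 0
  | S :: L => (if a ∈ S then 1 else 0) + occ a L

lemma mem_unionOf {a : ℕ} {L : List (Finset ℕ)} : a ∈ unionOf L ↔ ∃ S ∈ L, a ∈ S := by
  induction L with
  | nil => simp [unionOf]
  | cons S L ih => simp [unionOf, ih]

lemma unionOf_append (L M : List (Finset ℕ)) : unionOf (L ++ M) = unionOf L ∪ unionOf M := by
  ext a; simp only [mem_unionOf, Finset.mem_union, List.mem_append, or_and_right, exists_or]

lemma occ_append (a : ℕ) (L M : List (Finset ℕ)) : occ a (L ++ M) = occ a L + occ a M := by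
  induction L with
  | nil => simp [occ]
  | cons S L ih => simp [occ, ih, add_assoc]

lemma occ_eq_zero {a : ℕ} {L : List (Finset ℕ)} : occ a L = 0 ↔ a ∉ unionOf L := by
  induction L with
  | nil => simp [occ, unionOf]
  | cons S L ih => by_cases h : a ∈ S <;> simp [occ, unionOf, ih, h]

lemma push_of_not_subset {D S : Finset ℕ} {L : List (Finset ℕ)} (h : ¬ S ⊆ D \ unionOf L) :
    push D S L = S :: L := if_neg h

lemma push_nil {D S : Finset ℕ} (h : S ⊆ D) : push D S [] = [] := by
  simp [push, unionOf, h, mergeHead]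

lemma push_cons {D S T : Finset ℕ} {L : List (Finset ℕ)} (h : S ⊆ D \ unionOf (T :: L)) :
    push D S (T :: L) = (S ∪ T) :: L := by
  simp only [push, if_pos h, mergeHead]

/-- The three possible outcomes of `push`. -/
lemma push_cases (D S : Finset ℕ) (L : List (Finset ℕ)) :
    (¬ S ⊆ D \ unionOf L ∧ push D S L = S :: L) ∨
    (S ⊆ D ∧ L = [] ∧ push D S L = []) ∨
    (∃ T M, L = T :: M ∧ S ⊆ D ∧ Disjoint S T ∧ Disjoint S (unionOf M) ∧
      push D S L = (S ∪ T) :: M) := by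
  by_cases h : S ⊆ D \ unionOf L
  · cases L with
    | nil =>
      have : S ⊆ D := h.trans sdiff_subset
      exact Or.inr (Or.inl ⟨this, rfl, push_nil this⟩)
    | cons T M =>
      have h' := h
      rw [Finset.subset_sdiff, unionOf, Finset.disjoint_union_right] at h'
      exact Or.inr (Or.inr ⟨T, M, rfl, h'.1, h'.2.1, h'.2.2, push_cons h⟩)
  · exact Or.inl ⟨h, push_of_not_subset h⟩

lemma unionOf_push_subset (D S : Finset ℕ) (L : List (Finset ℕ)) :
    unionOf (push D S L) ⊆ S ∪ unionOf L := by
  rcases push_cases D S L with ⟨-, h⟩ | ⟨-, rfl, h⟩ | ⟨T, M, rfl, -, -, -, h⟩ <;>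
    rw [h] <;> simp [unionOf, Finset.union_assoc]

lemma subset_unionOf_push (D S : Finset ℕ) (L : List (Finset ℕ)) :
    unionOf L ⊆ unionOf (push D S L) := by
  rcases push_cases D S L with ⟨-, h⟩ | ⟨-, rfl, h⟩ | ⟨T, M, rfl, -, -, -, h⟩ <;>
    rw [h] <;> simp [unionOf, Finset.union_assoc]

lemma unionOf_norm_subset (D : Finset ℕ) (L : List (Finset ℕ)) :
    unionOf (norm D L) ⊆ unionOf L := by
  induction L with
  | nil => simp [norm]
  | cons S L ih =>
    exact (unionOf_push_subset D S _).trans (Finset.union_subset_union_right ih)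

lemma occ_push_le (a : ℕ) (D S : Finset ℕ) (L : List (Finset ℕ)) :
    occ a (push D S L) ≤ (if a ∈ S then 1 else 0) + occ a L := by
  rcases push_cases D S L with ⟨-, h⟩ | ⟨-, rfl, h⟩ | ⟨T, M, rfl, -, hd, -, h⟩ <;> rw [h]
  · simp [occ]
  · simp [occ]
  · by_cases h1 : a ∈ S <;> by_cases h2 : a ∈ T <;> simp [occ, h1, h2]

lemma occ_push {a : ℕ} {D S : Finset ℕ} {L : List (Finset ℕ)} (ha : a ∉ D) :
    occ a (push D S L) = (if a ∈ S then 1 else 0) + occ a L := by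
  rcases push_cases D S L with ⟨-, h⟩ | ⟨hs, rfl, h⟩ | ⟨T, M, rfl, hs, hd, -, h⟩ <;> rw [h]
  · simp [occ]
  · have : a ∉ S := fun h => ha (hs h)
    simp [occ, this]
  · have : a ∉ S := fun h => ha (hs h)
    simp [occ, this]

lemma occ_norm_le (a : ℕ) (D : Finset ℕ) (L : List (Finset ℕ)) :
    occ a (norm D L) ≤ occ a L := by
  induction L with
  | nil => simp [norm]
  | cons S L ih => exact (occ_push_le a D S _).trans (Nat.add_le_add_left ih _)

lemma occ_norm {a : ℕ} {D : Finset ℕ} (ha : a ∉ D) (L : List (Finset ℕ)) :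
    occ a (norm D L) = occ a L := by
  induction L with
  | nil => simp [norm]
  | cons S L ih => rw [norm, occ_push ha, ih, occ]

lemma IsNormal.push {D : Finset ℕ} {L : List (Finset ℕ)} (hL : IsNormal D L) (S : Finset ℕ) :
    IsNormal D (push D S L) := by
  rcases push_cases D S L with ⟨h1, h⟩ | ⟨-, rfl, h⟩ | ⟨T, M, rfl, -, -, -, h⟩ <;> rw [h]
  · exact ⟨h1, hL⟩
  · exact hL
  · exact ⟨fun hs => hL.1 (Finset.union_subset_right hs), hL.2⟩

lemma isNormal_norm (D : Finset ℕ) (L : List (Finset ℕ)) : IsNormal D (norm D L) := by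
  induction L with
  | nil => trivial
  | cons S L ih => exact ih.push S

lemma IsNormal.norm_eq {D : Finset ℕ} {L : List (Finset ℕ)} (hL : IsNormal D L) :
    norm D L = L := by
  induction L with
  | nil => rfl
  | cons S L ih => rw [norm, ih hL.2, push_of_not_subset hL.1]

lemma IsNormal.nonempty {D : Finset ℕ} {L : List (Finset ℕ)} (hL : IsNormal D L) :
    ∀ S ∈ L, S.Nonempty := by
  induction L with
  | nil => simp
  | cons S L ih =>
    intro T hT
    rcases List.mem_cons.mp hT with rfl | hT
    · rw [Finset.nonempty_iff_ne_empty]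
      rintro rfl
      exact hL.1 (Finset.empty_subset _)
    · exact ih hL.2 T hT

lemma isNormal_of_disjoint {D : Finset ℕ} {L : List (Finset ℕ)} (hne : ∀ S ∈ L, S.Nonempty)
    (hd : Disjoint D (unionOf L)) : IsNormal D L := by
  induction L with
  | nil => trivial
  | cons S L ih =>
    rw [unionOf, Finset.disjoint_union_right] at hd
    refine ⟨fun hs => ?_, ih (fun T hT => hne T (List.mem_cons_of_mem _ hT)) hd.2⟩
    obtain ⟨a, ha⟩ := hne S (by simp)
    exact Finset.disjoint_left.mp hd.1 (Finset.mem_sdiff.mp (hs ha)).1 ha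

/-- A merge forced by `D` is also forced by the larger `D'`, and merging `S`, `T` and the round
after them gives the same union in either order. -/
lemma norm_push {D D' : Finset ℕ} (h : D ⊆ D') (S : Finset ℕ) (L : List (Finset ℕ)) :
    norm D' (push D S L) = push D' S (norm D' L) := by
  rcases push_cases D S L with ⟨h1, he⟩ | ⟨hs, rfl, he⟩ | ⟨T, M, rfl, hs, hST, hSM, he⟩ <;> rw [he]
  · rfl
  · rw [norm, push_nil (hs.trans h)]
  · have hSM' : Disjoint S (unionOf (norm D' M)) := hSM.mono_right (unionOf_norm_subset _ _)
    have hs' := hs.trans h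
    simp only [norm]
    generalize norm D' M = N at hSM'
    rcases push_cases D' T N with ⟨h1, he'⟩ | ⟨hT, rfl, he'⟩ | ⟨X, Y, rfl, hT, hTX, hTY, he'⟩ <;>
      rw [he']
    · rw [push_cons, push_of_not_subset fun hh => h1 (Finset.union_subset_right hh)]
      rw [Finset.subset_sdiff, unionOf, Finset.disjoint_union_right]
      exact ⟨hs', hST, hSM'⟩
    · rw [push_nil hs', push_nil (Finset.union_subset hs' hT)]
    · rw [unionOf, Finset.disjoint_union_right] at hSM'
      rw [push_cons, push_cons, Finset.union_assoc]
      · rw [Finset.subset_sdiff, unionOf, Finset.disjoint_union_right,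
          Finset.disjoint_union_right]
        exact ⟨hs', ⟨hST, hSM'.1⟩, hSM'.2⟩
      · rw [Finset.subset_sdiff, unionOf, Finset.disjoint_union_right,
          Finset.disjoint_union_left, Finset.disjoint_union_left]
        exact ⟨Finset.union_subset hs' hT, ⟨hSM'.1, hTX⟩, hSM'.2, hTY⟩

lemma norm_norm {D D' : Finset ℕ} (h : D ⊆ D') (L : List (Finset ℕ)) :
    norm D' (norm D L) = norm D' L := by
  induction L with
  | nil => rfl
  | cons S L ih => rw [norm, norm_push h, ih, norm]

/-- The result shows what happened: its head is `S` exactly if nothing was merged, because a merge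
adds a nonempty `T` disjoint from `S`. In a merge, `T` is the head minus `S`. -/
lemma push_injective {D S : Finset ℕ} {L L' : List (Finset ℕ)} (hL : IsNormal D L)
    (hL' : IsNormal D L') (h : push D S L = push D S L') : L = L' := by
  rcases push_cases D S L with ⟨h1, he⟩ | ⟨hs, rfl, he⟩ | ⟨T, M, rfl, hs, hST, hSM, he⟩ <;>
  rcases push_cases D S L' with ⟨h1', he'⟩ | ⟨hs', rfl, he'⟩ | ⟨T', M', rfl, hs', hST', hSM', he'⟩ <;>
    replace h := he.symm.trans (h.trans he')
  · exact (List.cons.inj h).2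
  · simp at h
  · obtain ⟨a, ha⟩ := hL'.nonempty T' (by simp)
    have := (List.cons.inj h).1
    exact (Finset.disjoint_left.mp hST' (this ▸ Finset.mem_union_right _ ha) ha).elim
  · simp at h
  · rfl
  · simp at h
  · obtain ⟨a, ha⟩ := hL.nonempty T (by simp)
    have := (List.cons.inj h).1
    exact (Finset.disjoint_left.mp hST (this.symm ▸ Finset.mem_union_right _ ha) ha).elim
  · simp at h
  · obtain ⟨h1, rfl⟩ := List.cons.inj h
    congr 1
    rw [← Finset.union_sdiff_cancel_left hST, h1, Finset.union_sdiff_cancel_left hST']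

lemma norm_eq_nil {D : Finset ℕ} {L : List (Finset ℕ)} (h : unionOf L ⊆ D) : norm D L = [] := by
  induction L with
  | nil => rfl
  | cons S L ih =>
    rw [unionOf] at h
    rw [norm, ih (Finset.union_subset_right h), push_nil (Finset.union_subset_left h)]

lemma norm_append {D : Finset ℕ} {L M : List (Finset ℕ)} (h : unionOf M ⊆ D) :
    norm D (L ++ M) = norm D L := by
  induction L with
  | nil => exact norm_eq_nil h
  | cons S L ih => rw [List.cons_append, norm, ih, norm]

/-! ### A simplex is determined by its vertices -/

lemma norm_eq_nil_iff {D : Finset ℕ} {L : List (Finset ℕ)} :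
    norm D L = [] ↔ unionOf L ⊆ D := by
  refine ⟨fun h => ?_, norm_eq_nil⟩
  intro a ha
  by_contra hD
  have := occ_norm hD L
  rw [h] at this
  exact occ_eq_zero.mp this.symm ha

/-- Pushing `S` loses its members only when nothing remains to merge into, that is, when every
process involved is a ghost. -/
lemma mem_unionOf_norm_cons {D S : Finset ℕ} {L : List (Finset ℕ)} {a : ℕ} :
    a ∈ unionOf (norm D (S :: L)) ↔
      a ∈ unionOf (norm D L) ∨ (a ∈ S ∧ ¬ unionOf (S :: L) ⊆ D) := by
  have hnil := @norm_eq_nil_iff D L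
  rw [norm]
  generalize norm D L = N at hnil
  rcases push_cases D S N with ⟨h1, he⟩ | ⟨hs, rfl, he⟩ | ⟨T, M, rfl, hs, hST, hSM, he⟩ <;> rw [he]
  · have : ¬ unionOf (S :: L) ⊆ D := by
      intro hh
      rw [unionOf] at hh
      rw [hnil.mpr (Finset.union_subset_right hh)] at h1
      exact h1 (by simpa [unionOf] using Finset.union_subset_left hh)
    simp only [unionOf, Finset.mem_union] at this ⊢
    tauto
  · have : unionOf (S :: L) ⊆ D := Finset.union_subset hs (hnil.mp rfl)
    simp [this]
  · have : ¬ unionOf (S :: L) ⊆ D := by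
      intro hh
      have := hnil.mpr (Finset.union_subset_right hh)
      simp at this
    simp only [unionOf, Finset.mem_union] at this ⊢
    tauto

/-- Each round of a normal list contains an active process or a ghost that occurs again later; the
last round leaves only the first option. -/
lemma IsNormal.exists_not_mem {D : Finset ℕ} {L : List (Finset ℕ)} (hL : IsNormal D L)
    (hne : L ≠ []) : ∃ a ∈ unionOf L, a ∉ D := by
  induction L with
  | nil => exact absurd rfl hne
  | cons S L ih =>
    obtain ⟨w, hw, hD⟩ := Finset.not_subset.mp hL.1
    by_cases hwD : w ∈ D
    · have hwu : w ∈ unionOf L := by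
        by_contra h; exact hD (Finset.mem_sdiff.mpr ⟨hwD, h⟩)
      obtain ⟨a, ha, haD⟩ := ih hL.2 (by rintro rfl; simp [unionOf] at hwu)
      exact ⟨a, Finset.mem_union_right _ ha, haD⟩
    · exact ⟨w, Finset.mem_union_left _ hw, hwD⟩

/-- From the last occurrence of `w` onwards some active `a` still takes part, so `w` remains visible
in the vertex of `a`. -/
lemma IsNormal.exists_mem_unionOf_norm {U D : Finset ℕ} {L : List (Finset ℕ)} {w : ℕ}
    (hL : IsNormal D L) (hU : unionOf L ⊆ U) (hw : w ∈ unionOf L) :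
    ∃ a ∈ U \ D, w ∈ unionOf (norm (U \ {a}) L) := by
  induction L with
  | nil => simp [unionOf] at hw
  | cons S L ih =>
    by_cases hwL : w ∈ unionOf L
    · obtain ⟨a, ha, h⟩ := ih hL.2 (Finset.union_subset_right hU) hwL
      exact ⟨a, ha, mem_unionOf_norm_cons.mpr (Or.inl h)⟩
    · obtain ⟨a, ha, haD⟩ := hL.exists_not_mem (by simp)
      refine ⟨a, Finset.mem_sdiff.mpr ⟨hU ha, haD⟩, mem_unionOf_norm_cons.mpr (Or.inr ⟨?_, ?_⟩)⟩
      · rw [unionOf, Finset.mem_union] at hw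
        tauto
      · intro h
        simpa using h ha

/-- In some vertex the first round is not merged: take a member of `S` that is active, or a vertex
that sees a later occurrence of a ghost in `S`. -/
lemma IsNormal.exists_push_norm {U D S : Finset ℕ} {L : List (Finset ℕ)}
    (hL : IsNormal D (S :: L)) (hU : unionOf (S :: L) ⊆ U) :
    ∃ a ∈ U \ D, norm (U \ {a}) (S :: L) = S :: norm (U \ {a}) L := by
  suffices ∃ a ∈ U \ D, ¬ S ⊆ (U \ {a}) \ unionOf (norm (U \ {a}) L) by
    obtain ⟨a, ha, h⟩ := this
    exact ⟨a, ha, push_of_not_subset h⟩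
  obtain ⟨w, hw, hD⟩ := Finset.not_subset.mp hL.1
  by_cases hwD : w ∈ D
  · have hwu : w ∈ unionOf L := by
      by_contra h; exact hD (Finset.mem_sdiff.mpr ⟨hwD, h⟩)
    obtain ⟨a, ha, h⟩ := hL.2.exists_mem_unionOf_norm (Finset.union_subset_right hU) hwu
    exact ⟨a, ha, fun hh => (Finset.mem_sdiff.mp (hh hw)).2 h⟩
  · refine ⟨w, Finset.mem_sdiff.mpr ⟨hU (Finset.mem_union_left _ hw), hwD⟩, fun h => ?_⟩
    simpa using h hw

lemma subset_head_norm {D S T : Finset ℕ} {L M : List (Finset ℕ)} (h : norm D (S :: L) = T :: M) :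
    S ⊆ T := by
  rw [norm] at h
  rcases push_cases D S (norm D L) with ⟨-, he⟩ | ⟨-, -, he⟩ | ⟨X, Y, -, -, -, -, he⟩ <;>
    rw [he] at h
  · rw [(List.cons.inj h).1]
  · simp at h
  · rw [← (List.cons.inj h).1]
    exact Finset.subset_union_left

theorem IsNormal.ext {U D : Finset ℕ} {L L' : List (Finset ℕ)} (hL : IsNormal D L)
    (hL' : IsNormal D L') (hU : unionOf L ⊆ U) (hU' : unionOf L' ⊆ U)
    (h : ∀ a ∈ U \ D, norm (U \ {a}) L = norm (U \ {a}) L') : L = L' := by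
  induction L generalizing L' with
  | nil =>
    cases L' with
    | nil => rfl
    | cons S L' =>
      obtain ⟨a, ha, he⟩ := hL'.exists_push_norm hU'
      have := h a ha
      rw [he] at this
      simp [norm] at this
  | cons S L ih =>
    cases L' with
    | nil =>
      obtain ⟨a, ha, he⟩ := hL.exists_push_norm hU
      have := h a ha
      rw [he] at this
      simp [norm] at this
    | cons S' L' =>
      have hSS : S = S' := by
        obtain ⟨a, ha, he⟩ := hL.exists_push_norm hU
        obtain ⟨b, hb, he'⟩ := hL'.exists_push_norm hU'
        -- The head of a list lies in the head of each of its nonempty vertex lists, and each of the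
        -- two lists has a vertex where its own head appears unchanged.
        exact Finset.Subset.antisymm (subset_head_norm ((h b hb).trans he'))
          (subset_head_norm ((h a ha).symm.trans he))
      subst hSS
      rw [ih hL.2 hL'.2 (Finset.union_subset_right hU) (Finset.union_subset_right hU')]
      intro a ha
      exact push_injective (isNormal_norm _ _) (isNormal_norm _ _) (h a ha)

end ImmediateSnapshot

namespace ImmediateSnapshot

/-! ### The face poset in terms of lists of rounds -/

/-- The face relation: `x` is obtained from `y` by turning the elements of `x.2` into ghosts. -/
def FaceLE (x y : List (Finset ℕ) × Finset ℕ) : Prop :=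
  y.2 ⊆ x.2 ∧ x.1 = norm x.2 y.1

/-- The ghosts that occur in no round, i.e. the set `G 0`. -/
def initialGhosts (x : List (Finset ℕ) × Finset ℕ) : Finset ℕ := x.2 \ unionOf x.1

/-- The pairs that encode the simplices of the immediate snapshot complex with support `U` and
round numbers `r`. -/
structure IsConfig (U : Finset ℕ) (r : ℕ → ℕ) (x : List (Finset ℕ) × Finset ℕ) : Prop where
  normal : IsNormal x.2 x.1
  ghosts_subset : x.2 ⊆ U
  rounds_subset : unionOf x.1 ⊆ U
  occ_le : ∀ a ∈ U, occ a x.1 ≤ r a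
  occ_eq : ∀ a ∈ U, a ∉ x.2 → occ a x.1 = r a

/-- The round numbers that remain after the processes in `S` have executed one round. -/
def roundsAfter (r : ℕ → ℕ) (S : Finset ℕ) (a : ℕ) : ℕ := r a - if a ∈ S then 1 else 0

/-- `push` as an operation on pairs. -/
def pushPair (S : Finset ℕ) (x : List (Finset ℕ) × Finset ℕ) : List (Finset ℕ) × Finset ℕ :=
  (push x.2 S x.1, x.2)

variable {U V S : Finset ℕ} {r : ℕ → ℕ} {x y z : List (Finset ℕ) × Finset ℕ} {p : ℕ}

lemma FaceLE.refl (hx : IsNormal x.2 x.1) : FaceLE x x := ⟨le_rfl, hx.norm_eq.symm⟩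

lemma FaceLE.initialGhosts_subset (h : FaceLE x y) : initialGhosts y ⊆ initialGhosts x := by
  refine Finset.sdiff_subset_sdiff h.1 ?_
  rw [h.2]
  exact unionOf_norm_subset _ _

lemma initialGhosts_cons (L : List (Finset ℕ)) (D : Finset ℕ) :
    initialGhosts (S :: L, D) = initialGhosts (L, D) \ S := by
  ext a; simp only [initialGhosts, unionOf, Finset.mem_sdiff, Finset.mem_union]; tauto

/-! ### Prepending a round as an embedding of face posets -/

lemma initialGhosts_pushPair : initialGhosts (pushPair S x) \ S = initialGhosts x \ S := by
  ext a
  have h1 := @unionOf_push_subset x.2 S x.1 a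
  have h2 := @subset_unionOf_push x.2 S x.1 a
  simp only [initialGhosts, pushPair, Finset.mem_sdiff, Finset.mem_union] at *
  tauto

lemma faceLE_pushPair_iff (hx : IsNormal x.2 x.1) :
    FaceLE (pushPair S x) (pushPair S y) ↔ FaceLE x y := by
  refine and_congr_right fun (h : y.2 ⊆ x.2) => ?_
  show push x.2 S x.1 = norm x.2 (push y.2 S y.1) ↔ _
  rw [norm_push h]
  exact ⟨push_injective hx (isNormal_norm _ _), fun h => by rw [h]⟩

lemma pushPair_injOn : Set.InjOn (pushPair S) {x | IsNormal x.2 x.1} := by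
  rintro ⟨L, D⟩ hx ⟨L', D'⟩ hy h
  obtain ⟨h1, rfl⟩ := Prod.mk.inj h
  exact Prod.ext (push_injective hx hy h1) rfl

lemma IsConfig.face (hx : IsConfig U r x) {D : Finset ℕ} (h : x.2 ⊆ D) (hD : D ⊆ U) :
    IsConfig U r (norm D x.1, D) where
  normal := isNormal_norm _ _
  ghosts_subset := hD
  rounds_subset := (unionOf_norm_subset _ _).trans hx.rounds_subset
  occ_le a ha := (occ_norm_le a D _).trans (hx.occ_le a ha)
  occ_eq a ha haD := (occ_norm haD _).trans (hx.occ_eq a ha fun h' => haD (h h'))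

/-- Together with `faceLE_pushPair_iff` this identifies the image of `pushPair S` with a smaller
complex, which is what the induction on rounds uses. -/
lemma isConfig_pushPair_iff (hS : S ⊆ U) (hr : ∀ a ∈ S, 1 ≤ r a) (hx : IsNormal x.2 x.1) :
    IsConfig U r (pushPair S x) ↔ IsConfig U (roundsAfter r S) x := by
  -- The second alternative is a push onto the empty list that drops `S`; then all of `S` are
  -- ghosts, for which only an upper bound is required.
  have key : ∀ a, occ a (push x.2 S x.1) = (if a ∈ S then 1 else 0) + occ a x.1 ∨
      (occ a (push x.2 S x.1) = 0 ∧ occ a x.1 = 0 ∧ (a ∈ S → a ∈ x.2)) := by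
    intro a
    rcases push_cases x.2 S x.1 with ⟨-, h⟩ | ⟨hs, h', h⟩ | ⟨T, M, h', hs, hd, -, h⟩ <;> rw [h]
    · left; rfl
    · right; rw [h']; exact ⟨rfl, rfl, fun h => hs h⟩
    · left
      rw [h']
      by_cases h1 : a ∈ S
      · have h2 : a ∉ T := Finset.disjoint_left.mp hd h1
        simp [occ, h1, h2]
      · simp [occ, h1]
  constructor
  · intro h
    refine ⟨hx, h.ghosts_subset, (subset_unionOf_push _ _ _).trans h.rounds_subset, ?_, ?_⟩
    · intro a ha
      have h1 : occ a (push x.2 S x.1) ≤ r a := h.occ_le a ha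
      have h2 := key a
      unfold roundsAfter
      split_ifs at * <;> omega
    · intro a ha hD
      have h1 : occ a (push x.2 S x.1) = r a := h.occ_eq a ha hD
      have h2 := key a
      have h3 := hr a
      unfold roundsAfter
      split_ifs at * with haS
      · simp only [haS, hD] at *
        simp at h2; omega
      · omega
  · intro h
    refine ⟨hx.push S, h.ghosts_subset, (unionOf_push_subset _ _ _).trans
      (Finset.union_subset hS h.rounds_subset), ?_, ?_⟩
    · intro a ha
      show occ a (push x.2 S x.1) ≤ r a
      have h1 := h.occ_le a ha
      have h2 := key a
      have h3 := hr a
      unfold roundsAfter at h1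
      split_ifs at * with haS
      · have := h3 haS; omega
      · omega
    · intro a ha hD
      show occ a (push x.2 S x.1) = r a
      have h1 := h.occ_eq a ha hD
      have h2 := key a
      have h3 := hr a
      unfold roundsAfter at h1
      split_ifs at * with haS
      · have := h3 haS
        simp only [haS, show a ∉ x.2 from hD] at h2
        simp at h2; omega
      · omega

lemma isConfig_cons_iff {L : List (Finset ℕ)} {D : Finset ℕ} :
    IsConfig U r (S :: L, D) ↔ (S ⊆ U ∧ ∀ a ∈ S, 1 ≤ r a) ∧ ¬ S ⊆ initialGhosts (L, D) ∧
      IsConfig U (roundsAfter r S) (L, D) := by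
  have hpush : ¬ S ⊆ initialGhosts (L, D) → pushPair S (L, D) = (S :: L, D) := fun h =>
    Prod.ext (push_of_not_subset h) rfl
  constructor
  · intro h
    have hS : S ⊆ U := Finset.union_subset_left h.rounds_subset
    have hr : ∀ a ∈ S, 1 ≤ r a := fun a ha => by
      have : occ a (S :: L) ≤ r a := h.occ_le a (hS ha)
      simp only [occ, ha, if_true] at this; omega
    refine ⟨⟨hS, hr⟩, h.normal.1, (isConfig_pushPair_iff hS hr (x := (L, D)) h.normal.2).mp ?_⟩
    rw [hpush h.normal.1]; exact h
  · rintro ⟨⟨hS, hr⟩, h1, h2⟩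
    rw [← hpush h1]
    exact (isConfig_pushPair_iff hS hr h2.normal).mpr h2

lemma sum_roundsAfter_lt (hS : S ⊆ U) (hne : S.Nonempty) (hr : ∀ a ∈ S, 1 ≤ r a) :
    ∑ a ∈ U, roundsAfter r S a < ∑ a ∈ U, r a := by
  obtain ⟨a, ha⟩ := hne
  refine Finset.sum_lt_sum (fun a _ => Nat.sub_le _ _) ⟨a, hS ha, ?_⟩
  have := hr a ha
  simp only [roundsAfter, ha, if_true]; omega

lemma finite_configs (U : Finset ℕ) (r : ℕ → ℕ) : {x | IsConfig U r x}.Finite := by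
  induction hn : ∑ a ∈ U, r a using Nat.strong_induction_on generalizing r with
  | _ n ih =>
    have hfin : (⋃ S ∈ {S : Finset ℕ | S ⊆ U ∧ S.Nonempty ∧ ∀ a ∈ S, 1 ≤ r a},
        (fun x : List (Finset ℕ) × Finset ℕ => (S :: x.1, x.2)) ''
          {x | IsConfig U (roundsAfter r S) x}).Finite := by
      refine Set.Finite.biUnion ((U.powerset.finite_toSet).subset fun S hS => ?_) fun S hS => ?_
      · simpa using hS.1
      · refine Set.Finite.image _ (ih _ ?_ _ rfl)
        rw [← hn]
        exact sum_roundsAfter_lt hS.1 hS.2.1 hS.2.2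
    refine ((U.powerset.finite_toSet.image fun D => (([] : List (Finset ℕ)), D)).union hfin).subset
      ?_
    rintro ⟨L, D⟩ hx
    cases L with
    | nil => exact Or.inl ⟨D, by simpa using hx.ghosts_subset, rfl⟩
    | cons S L =>
      obtain ⟨⟨h1, h2⟩, h3, h4⟩ := isConfig_cons_iff.mp hx
      refine Or.inr (Set.mem_biUnion ⟨h1, hx.normal.nonempty S (by simp), h2⟩ ⟨(L, D), h4, rfl⟩)

/-! ### Removing the simplices with given initial ghosts -/

/-- Minus the cardinality serves as rank, so fibres over smaller sets are removed first. -/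
lemma Erasable.of_antitone {α : Type*} {le : α → α → Prop} {Q : Set α} (hQ : Q.Finite)
    (f : α → Finset ℕ) (h : ∀ x ∈ Q, ∀ y ∈ Q, le x y → f y ⊆ f x)
    (hf : ∀ b, Erasable le {x ∈ Q | f x = b}) : Erasable le Q := by
  refine Erasable.of_fibers hQ f (fun b => -(b.card : ℤ)) (fun x hx y hy hle => ?_) hf
  rcases (h x hx y hy hle).eq_or_ssubset with h1 | h1
  · exact Or.inl h1.symm
  · right
    have := Finset.card_lt_card h1
    omega

/-- The first round of a list, or `∅` if there is none. -/
def firstRound : List (Finset ℕ) → Finset ℕ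
  | [] => ∅
  | S :: _ => S

lemma Erasable.pushPair_image {T : Set (List (Finset ℕ) × Finset ℕ)} (hT : Erasable FaceLE T)
    (hn : ∀ x ∈ T, IsNormal x.2 x.1) (S : Finset ℕ) : Erasable FaceLE (pushPair S '' T) :=
  hT.image _ (pushPair_injOn.mono hn) fun x hx _ _ => (faceLE_pushPair_iff (hn x hx)).symm

/-- The round `{p}` either still stands alone or has been merged, and a merge leaves `p` behind as a
ghost at its last occurrence. -/
lemma exists_cons_eq_push_iff {L : List (Finset ℕ)} {D : Finset ℕ} (hn : IsNormal D (S :: L)) :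
    (∃ L', IsNormal D L' ∧ S :: L = push D {p} L') ↔ S = {p} ∨ (p ∈ S ∧ p ∈ D \ unionOf L) := by
  constructor
  · rintro ⟨L', hL', h⟩
    rcases push_cases D {p} L' with ⟨-, he⟩ | ⟨-, -, he⟩ | ⟨T, M, rfl, hs, hd, hd', he⟩ <;>
      rw [he] at h
    · exact Or.inl (List.cons.inj h).1
    · simp at h
    · obtain ⟨rfl, rfl⟩ := List.cons.inj h
      right
      simp only [Finset.disjoint_singleton_left] at hd'
      simpa [hd'] using hs
  · rintro (rfl | ⟨h1, h2⟩)
    · exact ⟨L, hn.2, (push_of_not_subset hn.1).symm⟩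
    · have h3 : insert p (S \ {p}) = S := by
        rw [Finset.insert_sdiff_self_of_mem]
        exact h1
      refine ⟨(S \ {p}) :: L, ⟨fun h => hn.1 ?_, hn.2⟩, ?_⟩
      · rw [← h3]
        exact Finset.insert_subset h2 h
      · rw [push_cons]
        · rw [← Finset.insert_eq, h3]
        · rw [Finset.mem_sdiff] at h2
          simp [unionOf, h2]

/-- If `p` executes no round, the complex is a cone with apex `p`. -/
lemma erasable_of_rounds_eq_zero (hp : p ∈ U) (hr : r p = 0) (V : Finset ℕ) :
    Erasable FaceLE {x | IsConfig U r x ∧ initialGhosts x \ {p} = V} := by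
  have hins : ∀ D : Finset ℕ, insert p D \ {p} = D \ {p} := fun D => by
    ext a; simp only [Finset.mem_sdiff, Finset.mem_insert, Finset.mem_singleton]; tauto
  have hocc : ∀ {x}, IsConfig U r x → p ∉ unionOf x.1 := fun {x} hx => by
    have := hx.occ_le p hp
    rw [hr, Nat.le_zero] at this
    exact occ_eq_zero.mp this
  have hnormal : ∀ {L D D'}, p ∉ unionOf L → D \ {p} = D' \ {p} → IsNormal D L → IsNormal D' L := by
    intro L D D' hL hD h
    induction L with
    | nil => trivial
    | cons S L ih =>
      simp only [unionOf, Finset.mem_union, not_or] at hL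
      refine ⟨fun hs => h.1 fun a ha => ?_, ih hL.2 h.2⟩
      have h1 := hs ha
      have h2 : a ≠ p := by rintro rfl; exact hL.1 ha
      have h3 := Finset.ext_iff.mp hD a
      simp only [Finset.mem_sdiff, Finset.mem_singleton] at h1 h3 ⊢
      tauto
  have hmem : ∀ {L D D'}, D' ⊆ U → D \ {p} = D' \ {p} → IsConfig U r (L, D) →
      IsConfig U r (L, D') := by
    intro L D D' hU hD h
    have hL : p ∉ unionOf L := hocc h
    refine ⟨hnormal hL hD h.normal, hU, h.rounds_subset, h.occ_le, fun a ha haD => ?_⟩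
    by_cases hap : a = p
    · subst hap
      have := h.occ_le a ha
      simp only at this ⊢
      omega
    · refine h.occ_eq a ha fun haD' => haD ?_
      have h3 := Finset.ext_iff.mp hD a
      simp only [Finset.mem_sdiff, Finset.mem_singleton] at h3 haD' ⊢
      tauto
  -- Forgetting whether `p` is a ghost gives fibres that are empty or consist of two simplices, one
  -- with `p` as a ghost and one without. The rounds are unaffected because `p` occurs in none.
  refine Erasable.of_fibers ((finite_configs U r).subset fun x hx => hx.1)
    (fun x => (x.1, insert p x.2)) (fun b => -(b.2.card : ℤ)) ?_ ?_
  · rintro x hx y hy hle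
    rcases (Finset.insert_subset_insert p hle.1).eq_or_ssubset with h | h
    · left
      refine Prod.ext ?_ h.symm
      have : IsNormal x.2 y.1 := by
        refine hnormal (hocc hy.1) ?_ hy.1.normal
        have := congrArg (· \ {p}) h
        simpa only [hins] using this
      simp only [hle.2, this.norm_eq]
    · right
      have := Finset.card_lt_card h
      simp only
      omega
  · rintro ⟨L, E⟩
    rcases Set.eq_empty_or_nonempty {x | x ∈ {x | IsConfig U r x ∧ initialGhosts x \ {p} = V} ∧
      (x.1, insert p x.2) = (L, E)} with h | ⟨⟨L', D⟩, ⟨hx, hV⟩, he⟩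
    · rw [h]; exact .empty
    · obtain ⟨rfl, rfl⟩ := Prod.mk.inj he
      have h1 : IsConfig U r (L', insert p D) :=
        hmem (Finset.insert_subset hp hx.ghosts_subset) (hins D).symm hx
      have h2 : IsConfig U r (L', D \ {p}) :=
        hmem (sdiff_subset.trans hx.ghosts_subset) sdiff_idem.symm hx
      have hset : {x | x ∈ {x | IsConfig U r x ∧ initialGhosts x \ {p} = V} ∧
          (x.1, insert p x.2) = (L', insert p D)} = {(L', insert p D), (L', D \ {p})} := by
        ext ⟨M, F⟩
        simp only [Set.mem_ofPred_eq, Set.mem_insert_iff, Set.mem_singleton_iff, Prod.mk.injEq]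
        constructor
        · rintro ⟨-, rfl, hF⟩
          by_cases hpF : p ∈ F
          · left; rw [← hF, Finset.insert_eq_of_mem hpF]; simp
          · right
            have := congrArg (· \ {p}) hF
            simp only [hins, sdiff_eq_left.mpr (Finset.disjoint_singleton_right.mpr hpF)] at this
            exact ⟨rfl, this⟩
        · have hV' : ∀ {F}, F \ {p} = D \ {p} → initialGhosts (L', F) \ {p} = V := by
            intro F hF
            rw [← hV]
            simp only [initialGhosts]
            rw [sdiff_right_comm, hF, sdiff_right_comm]
          rintro (⟨rfl, rfl⟩ | ⟨rfl, rfl⟩)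
          · exact ⟨⟨h1, hV' (hins D)⟩, rfl, Finset.insert_idem p D⟩
          · exact ⟨⟨h2, hV' sdiff_idem⟩, rfl, by ext a; by_cases a = p <;> simp [*]⟩
      show Erasable FaceLE {x | x ∈ {x | IsConfig U r x ∧ initialGhosts x \ {p} = V} ∧
          (x.1, insert p x.2) = (L', insert p D)}
      rw [hset]
      refine Erasable.pair (fun h => ?_) (.refl h1.normal) ⟨?_, ?_⟩
      · have := (Prod.mk.inj h).2
        have h3 : p ∈ D \ {p} := this ▸ Finset.mem_insert_self p D
        simp at h3
      · exact sdiff_subset.trans (Finset.subset_insert _ _)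
      · exact h1.normal.norm_eq.symm

theorem erasable_configs (hp : p ∈ U) (V : Finset ℕ) :
    Erasable FaceLE {x | IsConfig U r x ∧ initialGhosts x \ {p} = V} := by
  induction hn : ∑ a ∈ U, r a using Nat.strong_induction_on generalizing r p V with
  | _ n ih =>
  rcases Nat.eq_zero_or_pos (r p) with hrp | hrp
  · exact erasable_of_rounds_eq_zero hp hrp V
  have hfin : ∀ {r : ℕ → ℕ} {P : List (Finset ℕ) × Finset ℕ → Prop},
      {x | IsConfig U r x ∧ P x}.Finite :=
    fun {r P} => (finite_configs U r).subset fun x hx => hx.1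
  set Q := {x | IsConfig U r x ∧ initialGhosts x \ {p} = V} with hQ
  -- Membership in `N` means that the list arises by letting `p` run alone first; `N` is closed
  -- under faces, so `Q \ N` is removed before `Q ∩ N`.
  set N : Set (List (Finset ℕ) × Finset ℕ) :=
    {x | ∃ L', IsNormal x.2 L' ∧ x.1 = push x.2 {p} L'} with hN
  have hsplit : Q = (Q \ N) ∪ (Q ∩ N) := (Set.sdiff_union_inter Q N).symm
  rw [hsplit]
  -- An empty list forces `p` to be a ghost, as `r p ≥ 1`; then the round `{p}` pushed onto the
  -- empty list vanishes, so the pair lies in `N`.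
  have hne : ∀ {L D}, (L, D) ∈ Q \ N → L ≠ [] := by
    rintro L D hx rfl
    refine hx.2 ⟨[], trivial, (push_nil ?_).symm⟩
    rw [Finset.singleton_subset_iff]
    by_contra hD
    have := hx.1.1.occ_eq p hp hD
    simp [occ] at this; omega
  refine Erasable.union ?_ ?_ (Set.disjoint_left.mpr fun x h1 h2 => h1.2 h2.2) ?_
  · refine Erasable.of_antitone (hfin.subset Set.sdiff_subset) (fun x => firstRound x.1) ?_ ?_
    · rintro ⟨L, D⟩ hx ⟨L', D'⟩ hy hle
      cases L with
      | nil => exact absurd rfl (hne hx)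
      | cons S L =>
        cases L' with
        | nil => exact absurd rfl (hne hy)
        | cons S' L' => exact subset_head_norm hle.2.symm
    · intro S
      rcases Set.eq_empty_or_nonempty {x ∈ Q \ N | firstRound x.1 = S} with h | ⟨⟨L, D⟩, hx, hxS⟩
      · rw [h]; exact .empty
      cases L with
      | nil => exact absurd rfl (hne hx)
      | cons S' L =>
      obtain rfl : S' = S := hxS
      obtain ⟨⟨hSU, hSr⟩, -, -⟩ := isConfig_cons_iff.mp hx.1.1
      have hlt := sum_roundsAfter_lt hSU (hx.1.1.normal.nonempty S' (by simp)) hSr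
      rw [hn] at hlt
      -- Cancelling the common first round `S'` moves the problem to smaller round numbers, with `P`
      -- recording the conditions on what is left. The first condition on `P` ensures that `S'` is
      -- never merged.
      have himage : ∀ P : List (Finset ℕ) × Finset ℕ → Prop,
          (∀ x, P x → ¬ S' ⊆ initialGhosts x) →
          (∀ L D, IsConfig U r (S' :: L, D) → ((S' :: L, D) ∈ Q \ N ↔ P (L, D))) →
          Erasable FaceLE {x | IsConfig U (roundsAfter r S') x ∧ P x} →
          Erasable FaceLE {x ∈ Q \ N | firstRound x.1 = S'} := by
        intro P hP1 hP2 hE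
        convert hE.pushPair_image (fun x hx => hx.1.normal) S' using 1
        ext ⟨M, F⟩
        constructor
        · rintro ⟨hM, hMS⟩
          cases M with
          | nil => exact absurd rfl (hne hM)
          | cons T M =>
            obtain rfl : T = S' := hMS
            refine ⟨(M, F), ⟨(isConfig_cons_iff.mp hM.1.1).2.2, (hP2 M F hM.1.1).mp hM⟩, ?_⟩
            exact Prod.ext (push_of_not_subset hM.1.1.normal.1) rfl
        · rintro ⟨⟨M', F'⟩, ⟨hM1, hM2⟩, he⟩
          have h1 := hP1 _ hM2
          have h2 : pushPair S' (M', F') = (S' :: M', F') :=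
            Prod.ext (push_of_not_subset h1) rfl
          rw [h2] at he
          obtain ⟨rfl, rfl⟩ := Prod.mk.inj he
          exact ⟨(hP2 _ _ (isConfig_cons_iff.mpr ⟨⟨hSU, hSr⟩, h1, hM1⟩)).mpr hM2, rfl⟩
      by_cases hpS : p ∈ S'
      · have hSp : S' ≠ {p} := fun h =>
          hx.2 ((exists_cons_eq_push_iff hx.1.1.normal).mpr (Or.inl h))
        obtain ⟨q, hqS, hqp⟩ : ∃ q ∈ S', q ≠ p := by
          by_contra! h
          exact hSp (Finset.eq_singleton_iff_unique_mem.mpr ⟨hpS, h⟩)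
        refine himage (fun x => p ∉ initialGhosts x ∧ (initialGhosts x \ S') \ {p} = V)
          (fun x hx h => hx.1 (h hpS)) ?_ ?_
        · intro M F hM
          have h1 : (S' :: M, F) ∈ N ↔ _ := exists_cons_eq_push_iff hM.normal
          rw [Set.mem_sdiff, h1, hQ, Set.mem_ofPred_eq, initialGhosts_cons]
          simp only [hM, hSp, hpS, initialGhosts, true_and, false_or]
          tauto
        -- Neither condition sees whether `q` is an initial ghost, as `q ≠ p` and `q ∈ S'`. So each
        -- class over `V'` is empty or a full block with apex `q`.
        · refine Erasable.of_antitone hfin (fun x => initialGhosts x \ {q})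
            (fun x _ y _ h => Finset.sdiff_subset_sdiff h.initialGhosts_subset le_rfl) fun V' => ?_
          by_cases hV' : p ∉ V' ∧ (V' \ S') \ {p} = V
          · convert ih _ hlt (hSU hqS) V' rfl using 1
            ext x
            simp only [Set.mem_ofPred_eq]
            constructor
            · rintro ⟨⟨h1, -⟩, h2⟩; exact ⟨h1, h2⟩
            · rintro ⟨h1, h2⟩
              refine ⟨⟨h1, ?_, ?_⟩, h2⟩
              · intro h; apply hV'.1; rw [← h2]; simp [h, hqp.symm]
              · rw [← hV'.2, ← h2]
                congr 1
                ext a; simp only [Finset.mem_sdiff, Finset.mem_singleton]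
                constructor
                · rintro ⟨h3, h4⟩; exact ⟨⟨h3, by rintro rfl; exact h4 hqS⟩, h4⟩
                · rintro ⟨⟨h3, -⟩, h4⟩; exact ⟨h3, h4⟩
          · convert Erasable.empty
            ext x
            simp only [Set.mem_ofPred_eq, Set.mem_empty_iff_false, iff_false]
            rintro ⟨⟨-, h1, h2⟩, h3⟩
            refine hV' ⟨fun h => h1 ?_, ?_⟩
            · rw [← h3] at h; exact (Finset.mem_sdiff.mp h).1
            · rw [← h2, ← h3]
              congr 1
              ext a; simp only [Finset.mem_sdiff, Finset.mem_singleton]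
              constructor
              · rintro ⟨⟨h3, -⟩, h4⟩; exact ⟨h3, h4⟩
              · rintro ⟨h3, h4⟩; exact ⟨⟨h3, by rintro rfl; exact h4 hqS⟩, h4⟩
      · refine himage (fun x => ¬ S' ⊆ initialGhosts x ∧ (initialGhosts x \ S') \ {p} = V)
          (fun x hx => hx.1) ?_ ?_
        · intro M F hM
          have h1 : (S' :: M, F) ∈ N ↔ _ := exists_cons_eq_push_iff hM.normal
          have h2 : ¬ S' ⊆ initialGhosts (M, F) := hM.normal.1
          have h3 : S' ≠ {p} := by rintro rfl; simp at hpS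
          rw [Set.mem_sdiff, h1, hQ, Set.mem_ofPred_eq, initialGhosts_cons]
          simp only [hM, h2, h3, hpS]
          tauto
        -- Here `p ∉ S'`, so the conditions do not depend on `p` and the apex is kept.
        · refine Erasable.of_antitone hfin (fun x => initialGhosts x \ {p})
            (fun x _ y _ h => Finset.sdiff_subset_sdiff h.initialGhosts_subset le_rfl) fun V' => ?_
          have hsub : ∀ X : Finset ℕ, S' ⊆ X ↔ S' ⊆ X \ {p} := fun X => by
            rw [Finset.subset_sdiff]; simp [hpS]
          by_cases hV' : ¬ S' ⊆ V' ∧ V' \ S' = V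
          · convert ih _ hlt hp V' rfl using 1
            ext x
            simp only [Set.mem_ofPred_eq]
            constructor
            · rintro ⟨⟨h1, -⟩, h2⟩; exact ⟨h1, h2⟩
            · rintro ⟨h1, h2⟩
              refine ⟨⟨h1, ?_, ?_⟩, h2⟩
              · rw [hsub, h2]; exact hV'.1
              · rw [sdiff_right_comm, h2, hV'.2]
          · convert Erasable.empty
            ext x
            simp only [Set.mem_ofPred_eq, Set.mem_empty_iff_false, iff_false]
            rintro ⟨⟨-, h1, h2⟩, h3⟩
            rw [hsub, h3] at h1
            rw [sdiff_right_comm, h3] at h2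
            exact hV' ⟨h1, h2⟩
  · have hpU : ({p} : Finset ℕ) ⊆ U := by simpa using hp
    have hpr : ∀ a ∈ ({p} : Finset ℕ), 1 ≤ r a := fun a ha => by
      rwa [Finset.mem_singleton.mp ha]
    have hlt := sum_roundsAfter_lt hpU (by simp) hpr
    rw [hn] at hlt
    convert (ih _ hlt hp V rfl).pushPair_image (fun x hx => hx.1.normal) {p} using 1
    ext ⟨M, F⟩
    constructor
    · rintro ⟨⟨h1, h2⟩, L', hL', h⟩
      have he : (M, F) = pushPair {p} (L', F) := Prod.ext h rfl
      rw [he, isConfig_pushPair_iff hpU hpr hL'] at h1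
      rw [he, initialGhosts_pushPair] at h2
      exact ⟨(L', F), ⟨h1, h2⟩, he.symm⟩
    · rintro ⟨⟨L', F'⟩, ⟨h1, h2⟩, he⟩
      obtain ⟨h3, rfl⟩ := Prod.mk.inj he
      rw [← he]
      exact ⟨⟨(isConfig_pushPair_iff hpU hpr h1.normal).mpr h1,
        initialGhosts_pushPair.trans h2⟩, L', h1.normal, rfl⟩
  · rintro x hx y ⟨hy, L', hL', hyL⟩ hle
    -- A face of an element of `N` is in `N`, because ghosting commutes with prepending `{p}`.
    refine hx.2 ⟨norm x.2 L', isNormal_norm _ _, ?_⟩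
    rw [hle.2, hyL, norm_push hle.1]

end ImmediateSnapshot

namespace ImmediateSnapshot

/-! ### The encoding of witness structures by lists of rounds -/

lemma getD_map_range (n i : ℕ) (f : ℕ → Finset ℕ) :
    ((List.range n).map f).getD i ∅ = if i < n then f i else ∅ := by
  by_cases h : i < n <;> simp [List.getD, h]

lemma mem_unionOf_drop {a i : ℕ} {L : List (Finset ℕ)} :
    a ∈ unionOf (L.drop i) ↔ ∃ j, i ≤ j ∧ a ∈ L.getD j ∅ := by
  rw [mem_unionOf]
  constructor
  · rintro ⟨S, hS, ha⟩
    obtain ⟨k, hk, rfl⟩ := List.mem_iff_getElem.mp hS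
    refine ⟨i + k, by omega, ?_⟩
    rw [List.getElem_drop] at ha
    rw [List.length_drop] at hk
    rw [List.getD_eq_getElem _ _ (by omega)]
    exact ha
  · rintro ⟨j, hij, ha⟩
    have hj : j < L.length := by
      by_contra h
      rw [List.getD_eq_default _ _ (by omega)] at ha
      simp at ha
    rw [List.getD_eq_getElem _ _ hj] at ha
    refine ⟨_, List.mem_iff_getElem.mpr ⟨j - i, by rw [List.length_drop]; omega, ?_⟩, ha⟩
    rw [List.getElem_drop]
    congr 1; omega

/-! ### Ghosting described by positions in the list -/

lemma isNormal_iff {D : Finset ℕ} {L : List (Finset ℕ)} :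
    IsNormal D L ↔ ∀ i < L.length, ¬ L.getD i ∅ ⊆ D \ unionOf (L.drop (i + 1)) := by
  induction L with
  | nil => simp [IsNormal]
  | cons S L ih =>
    rw [IsNormal, ih]
    constructor
    · rintro ⟨h1, h2⟩ i hi
      cases i with
      | zero => simpa using h1
      | succ i => simpa using h2 i (by simpa using hi)
    · intro h
      exact ⟨by simpa using h 0 (by simp), fun i hi => by simpa using h (i + 1) (by simpa using hi)⟩

/-- Only what comes after the last round with a process outside `D` is lost; this is the truncation
in the stabilization. -/
lemma mem_unionOf_norm {D : Finset ℕ} {L : List (Finset ℕ)} {a : ℕ} :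
    a ∈ unionOf (norm D L) ↔ ∃ j k, j ≤ k ∧ a ∈ L.getD j ∅ ∧ ¬ L.getD k ∅ ⊆ D := by
  induction L with
  | nil => simp [norm, unionOf]
  | cons S L ih =>
    rw [mem_unionOf_norm_cons, ih]
    constructor
    · rintro (⟨j, k, h1, h2, h3⟩ | ⟨h1, h2⟩)
      · exact ⟨j + 1, k + 1, by omega, by simpa using h2, by simpa using h3⟩
      · obtain ⟨b, hb, hbD⟩ := Finset.not_subset.mp h2
        have hb' := (mem_unionOf_drop (i := 0)).mp hb
        obtain ⟨k, -, hk⟩ := hb'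
        exact ⟨0, k, by omega, by simpa using h1, fun h => hbD (h hk)⟩
    · rintro ⟨j, k, h1, h2, h3⟩
      cases j with
      | zero =>
        refine Or.inr ⟨by simpa using h2, fun h => h3 fun b hb => h ?_⟩
        exact (mem_unionOf_drop (i := 0)).mpr ⟨k, by omega, hb⟩
      | succ j =>
        cases k with
        | zero => omega
        | succ k => exact Or.inl ⟨j, k, by omega, by simpa using h2, by simpa using h3⟩

/-- Round `i` of the list survives ghosting as a round of its own. -/
def Survives (D : Finset ℕ) (L : List (Finset ℕ)) (i : ℕ) : Prop :=
  ¬ L.getD i ∅ ⊆ D \ unionOf (norm D (L.drop (i + 1)))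

lemma survives_cons_succ {D S : Finset ℕ} {L : List (Finset ℕ)} {i : ℕ} :
    Survives D (S :: L) (i + 1) ↔ Survives D L i := by
  simp [Survives]

lemma survives_iff {D : Finset ℕ} {L : List (Finset ℕ)} {i : ℕ} :
    Survives D L i ↔ ∃ a ∈ L.getD i ∅, a ∉ D ∨
      ∃ j k, i < j ∧ j ≤ k ∧ a ∈ L.getD j ∅ ∧ ¬ L.getD k ∅ ⊆ D := by
  have hd : ∀ j, (L.drop (i + 1)).getD j ∅ = L.getD (i + 1 + j) ∅ := fun j => by
    simp [List.getD, List.getElem?_drop]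
  simp only [Survives, Finset.not_subset, Finset.mem_sdiff, mem_unionOf_norm, hd, not_and_or,
    not_not]
  refine exists_congr fun a => and_congr_right fun ha => or_congr_right ?_
  constructor
  · rintro ⟨j, k, h1, h2, h3⟩
    exact ⟨i + 1 + j, i + 1 + k, by omega, by omega, h2, h3⟩
  · rintro ⟨j, k, h0, h1, h2, h3⟩
    refine ⟨j - (i + 1), k - (i + 1), by omega, ?_, ?_⟩
    · rwa [show i + 1 + (j - (i + 1)) = j by omega]
    · rwa [show i + 1 + (k - (i + 1)) = k by omega]

open Classical in
lemma length_norm (D : Finset ℕ) (L : List (Finset ℕ)) :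
    (norm D L).length = Nat.count (Survives D L) L.length := by
  induction L with
  | nil => simp [norm]
  | cons S L ih =>
    rw [List.length_cons, Nat.count_succ']
    simp only [survives_cons_succ]
    rw [norm, ← ih]
    have h0 : Survives D (S :: L) 0 ↔ ¬ S ⊆ D \ unionOf (norm D L) := by simp [Survives]
    rw [h0, push]
    split_ifs with h
    · cases norm D L <;> simp [mergeHead]
    · simp

-- A round is merged forward up to the next surviving one, so its new position is the number of
-- survivors strictly before it. This is the list version of `slot`.
open Classical in
lemma mem_getD_norm {D : Finset ℕ} {L : List (Finset ℕ)} {k a : ℕ} (hk : k < (norm D L).length) :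
    a ∈ (norm D L).getD k ∅ ↔
      ∃ i < L.length, Nat.count (Survives D L) i = k ∧ a ∈ L.getD i ∅ := by
  induction L generalizing k with
  | nil => simp [norm] at hk
  | cons S L ih =>
    have hsplit : (∃ i < (S :: L).length, Nat.count (Survives D (S :: L)) i = k ∧
        a ∈ (S :: L).getD i ∅) ↔ (k = 0 ∧ a ∈ S) ∨ ∃ i < L.length,
          Nat.count (Survives D L) i + (if Survives D (S :: L) 0 then 1 else 0) = k ∧
            a ∈ L.getD i ∅ := by
      constructor
      · rintro ⟨i, h1, h2, h3⟩
        cases i with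
        | zero => exact Or.inl ⟨by simpa using h2.symm, by simpa using h3⟩
        | succ i =>
          rw [Nat.count_succ'] at h2
          simp only [survives_cons_succ] at h2
          exact Or.inr ⟨i, by simpa using h1, h2, by simpa using h3⟩
      · rintro (⟨rfl, h⟩ | ⟨i, h1, h2, h3⟩)
        · exact ⟨0, by simp, by simp, by simpa using h⟩
        · refine ⟨i + 1, by simpa using h1, ?_, by simpa using h3⟩
          rw [Nat.count_succ']
          simpa only [survives_cons_succ] using h2
    rw [hsplit]
    have h0 : Survives D (S :: L) 0 ↔ ¬ S ⊆ D \ unionOf (norm D L) := by simp [Survives]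
    rw [norm] at hk ⊢
    by_cases h : S ⊆ D \ unionOf (norm D L)
    · have h0' : ¬ Survives D (S :: L) 0 := by rw [h0]; exact not_not.mpr h
      simp only [h0', if_false, add_zero]
      rw [push, if_pos h] at hk ⊢
      generalize hN : norm D L = N at hk
      rw [hN] at ih
      cases N with
      | nil => simp [mergeHead] at hk
      | cons T M =>
        rw [← ih (by simpa [mergeHead] using hk)]
        cases k with
        | zero => simp [mergeHead]
        | succ k => simp [mergeHead]
    · have h0' : Survives D (S :: L) 0 := h0.mpr h
      simp only [h0', if_true]
      rw [push, if_neg h] at hk ⊢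
      cases k with
      | zero => simp
      | succ k =>
        rw [List.getD_cons_succ, ih (by simpa using hk)]
        simp

lemma occ_map_range (a n : ℕ) (f : ℕ → Finset ℕ) :
    occ a ((List.range n).map f) = ((range n).filter fun i => a ∈ f i).card := by
  induction n with
  | zero => simp [occ]
  | succ n ih =>
    rw [List.range_succ, List.map_append, occ_append, ih, Finset.range_add_one, Finset.filter_insert]
    split_ifs with h
    · rw [Finset.card_insert_of_notMem (by simp)]
      simp [occ, h]
    · simp [occ, h]

namespace WitnessPrestructure

variable {σ τ : WitnessPrestructure} {S : Finset ℕ} {i p : ℕ}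

/-- The list `[R 1, …, R t]`. -/
def rounds (σ : WitnessPrestructure) : List (Finset ℕ) :=
  (List.range σ.t).map fun i => σ.R (i + 1)

/-- The encoding of a witness structure by its rounds and its ghosts. -/
def encode (σ : WitnessPrestructure) : List (Finset ℕ) × Finset ℕ := (σ.rounds, σ.ghosts)

lemma R_of_lt (h : σ.t < i) : σ.R i = ∅ := by
  rw [R, σ.W_of_lt i h, σ.G_of_lt i h, Finset.empty_union]

lemma getD_rounds : σ.rounds.getD i ∅ = σ.R (i + 1) := by
  rw [rounds, getD_map_range]
  split_ifs with h
  · rfl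
  · rw [R_of_lt (by omega)]

@[simp] lemma length_rounds : σ.rounds.length = σ.t := by simp [rounds]

lemma mem_ghosts : p ∈ σ.ghosts ↔ ∃ i, p ∈ σ.G i := by
  simp only [ghosts, Finset.mem_biUnion, Finset.mem_range]
  refine ⟨fun ⟨i, _, h⟩ => ⟨i, h⟩, fun ⟨i, h⟩ => ⟨i, ?_, h⟩⟩
  by_contra hi
  rw [σ.G_of_lt i (by omega)] at h
  simp at h

lemma mem_G_iff : p ∈ σ.G i ↔ p ∈ σ.R i ∧ p ∈ σ.ghosts ∧ ∀ j, i < j → p ∉ σ.R j := by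
  constructor
  · refine fun h => ⟨Finset.mem_union_right _ h, mem_ghosts.mpr ⟨i, h⟩, fun j hj hp => ?_⟩
    rcases Finset.mem_union.mp hp with h' | h'
    · exact Finset.disjoint_left.mp (σ.G_disjoint_W i j hj.le) h h'
    · exact Finset.disjoint_left.mp (σ.G_disjoint i j hj) h h'
  · rintro ⟨h1, h2, h3⟩
    obtain ⟨j, hj⟩ := mem_ghosts.mp h2
    rcases lt_trichotomy i j with h | rfl | h
    · exact absurd (Finset.mem_union_right _ hj) (h3 j h)
    · exact hj
    · rcases Finset.mem_union.mp h1 with h' | h'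
      · exact (Finset.disjoint_left.mp (σ.G_disjoint_W j i h.le) hj h').elim
      · exact h'

lemma mem_W_iff : p ∈ σ.W i ↔ p ∈ σ.R i ∧ p ∉ σ.G i := by
  simp only [R, Finset.mem_union]
  have h : p ∈ σ.G i → p ∉ σ.W i := fun h => Finset.disjoint_left.mp (σ.G_disjoint_W i i le_rfl) h
  tauto

lemma R_subset_supp (σ : WitnessPrestructure) (i : ℕ) : σ.R i ⊆ σ.supp := by
  rcases Nat.eq_zero_or_pos i with rfl | h
  · exact le_rfl
  · exact (σ.R_subset i h).trans Finset.subset_union_left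

lemma ghosts_subset_supp (σ : WitnessPrestructure) : σ.ghosts ⊆ σ.supp := fun p hp => by
  obtain ⟨i, hi⟩ := mem_ghosts.mp hp
  exact σ.R_subset_supp i (Finset.mem_union_right _ hi)

lemma mem_unionOf_rounds : p ∈ unionOf σ.rounds ↔ ∃ i, p ∈ σ.R (i + 1) := by
  have := mem_unionOf_drop (a := p) (i := 0) (L := σ.rounds)
  simpa only [List.drop_zero, Nat.zero_le, true_and, getD_rounds] using this

lemma encode_inj (hs : σ.supp = τ.supp) (h : σ.encode = τ.encode) : σ = τ := by
  obtain ⟨h1, h2⟩ := Prod.mk.inj h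
  have ht : σ.t = τ.t := by rw [← length_rounds, h1, length_rounds]
  have hR : σ.R = τ.R := by
    funext i
    cases i with
    | zero => exact hs
    | succ i => rw [← getD_rounds, ← getD_rounds, h1]
  have hG : σ.G = τ.G := by
    funext i; ext p; rw [mem_G_iff, mem_G_iff, hR, h2]
  refine WitnessPrestructure.ext ht ?_ hG
  funext i; ext p; rw [mem_W_iff, mem_W_iff, hR, hG]

lemma initialGhosts_encode : initialGhosts σ.encode = σ.G 0 := by
  ext p
  rw [mem_G_iff, initialGhosts, Finset.mem_sdiff]
  simp only [encode, mem_unionOf_rounds, not_exists]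
  constructor
  · rintro ⟨h1, h2⟩
    refine ⟨σ.ghosts_subset_supp h1, h1, fun j hj => ?_⟩
    obtain ⟨j, rfl⟩ : ∃ k, j = k + 1 := ⟨j - 1, by omega⟩
    exact h2 j
  · rintro ⟨-, h1, h2⟩
    exact ⟨h1, fun j => h2 _ (by omega)⟩

lemma isNormal_encode : IsNormal σ.ghosts σ.rounds ↔ σ.IsWitnessStructure := by
  rw [isNormal_iff, length_rounds]
  have key : ∀ i, ¬ σ.rounds.getD i ∅ ⊆ σ.ghosts \ unionOf (σ.rounds.drop (i + 1)) ↔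
      (σ.W (i + 1)).Nonempty := by
    intro i
    rw [Finset.not_subset]
    refine exists_congr fun p => ?_
    rw [mem_W_iff, mem_G_iff, Finset.mem_sdiff, mem_unionOf_drop]
    simp only [getD_rounds]
    refine and_congr_right fun hp => not_congr ?_
    simp only [hp, true_and, not_exists, not_and]
    refine and_congr_right fun _ => ⟨fun h j hj => ?_, fun h j hj => h (j + 1) (by omega)⟩
    obtain ⟨j, rfl⟩ : ∃ k, j = k + 1 := ⟨j - 1, by omega⟩
    exact h j (by omega)
  simp only [key]
  refine ⟨fun h i h1 h2 => ?_, fun h i hi => h (i + 1) (by omega) (by omega)⟩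
  have := h (i - 1) (by omega)
  rwa [Nat.sub_add_cancel h1] at this

/-- The extra `1` is the index `0`, which lies in the trace of every process of the support. -/
lemma M_eq (hp : p ∈ σ.supp) : σ.M p = occ p σ.rounds + 1 := by
  rw [rounds, occ_map_range, M, trace, Finset.card_filter, Finset.card_filter,
    Finset.sum_range_succ', if_pos (show p ∈ σ.R 0 from hp)]

lemma exists_encode_eq {U D : Finset ℕ} {L : List (Finset ℕ)} (hD : D ⊆ U)
    (hL : unionOf L ⊆ U) : ∃ σ : WitnessPrestructure, σ.supp = U ∧ σ.encode = (L, D) := by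
  -- The prescribed columns `R i`, with `R 0 = U`; the ghost columns `g` below select the last
  -- occurrences of members of `D`.
  set f : ℕ → Finset ℕ := fun i => (U :: L).getD i ∅ with hf
  have hfU : ∀ i, f i ⊆ U := by
    intro i
    cases i with
    | zero => simp [hf]
    | succ i =>
      refine fun a ha => hL ((mem_unionOf_drop (i := 0)).mpr ⟨i, by omega, ?_⟩)
      simpa [hf] using ha
  have hflt : ∀ i, L.length < i → f i = ∅ := fun i hi =>
    List.getD_eq_default _ _ (by simpa using hi)
  set g : ℕ → Finset ℕ := fun i =>
    (f i).filter fun p => p ∈ D ∧ ∀ j ∈ Ioc i L.length, p ∉ f j with hg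
  have hmem : ∀ {p i}, p ∈ g i ↔ p ∈ f i ∧ p ∈ D ∧ ∀ j, i < j → p ∉ f j := by
    intro p i
    simp only [hg, Finset.mem_filter, Finset.mem_Ioc]
    refine and_congr_right fun _ => and_congr_right fun _ => ⟨fun h j hj => ?_,
      fun h j hj => h j hj.1⟩
    by_cases hjL : j ≤ L.length
    · exact h j ⟨hj, hjL⟩
    · rw [hflt j (by omega)]; simp
  have h0 : ∀ i, 1 ≤ i → f i ⊆ f 0 \ g 0 := by
    intro i hi p hp
    refine Finset.mem_sdiff.mpr ⟨by simpa [hf] using hfU i hp, fun h => ?_⟩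
    exact (hmem.mp h).2.2 i hi hp
  let σ : WitnessPrestructure :=
    { t := L.length
      W := fun i => f i \ g i
      G := g
      W_of_lt := fun i hi => by rw [hflt i hi, Finset.empty_sdiff]
      G_of_lt := fun i hi => by simp only [hg, hflt i hi, Finset.filter_empty]
      W_subset := fun i hi => sdiff_subset.trans (h0 i hi)
      G_subset := fun i hi => (Finset.filter_subset _ _).trans (h0 i hi)
      G_disjoint := fun i j hij => Finset.disjoint_left.mpr fun p h1 h2 =>
        (hmem.mp h1).2.2 j hij (hmem.mp h2).1
      G_disjoint_W := fun i j hij => Finset.disjoint_left.mpr fun p h1 h2 => by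
        rw [Finset.mem_sdiff] at h2
        rcases hij.eq_or_lt with rfl | h
        · exact h2.2 h1
        · exact (hmem.mp h1).2.2 j h h2.1 }
  have hR : ∀ i, σ.R i = f i := fun i => Finset.sdiff_union_of_subset (Finset.filter_subset _ _)
  refine ⟨σ, (hR 0).trans (by simp [hf]), Prod.ext ?_ ?_⟩
  · refine List.ext_getElem (by simp [encode, σ]) fun i h1 h2 => ?_
    have : σ.rounds.getD i ∅ = L.getD i ∅ := by
      rw [getD_rounds, hR]; simp [hf]
    exact (List.getD_eq_getElem σ.encode.1 ∅ h1).symm.trans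
      (this.trans (List.getD_eq_getElem L ∅ h2))
  · ext p
    show p ∈ σ.ghosts ↔ p ∈ D
    rw [mem_ghosts]
    refine ⟨fun ⟨i, hi⟩ => (hmem.mp hi).2.1, fun hp => ?_⟩
    obtain ⟨i, hi, hmax⟩ := Finset.exists_max_image
      ((range (L.length + 1)).filter fun i => p ∈ f i) id ⟨0, by simpa [hf] using hD hp⟩
    simp only [Finset.mem_filter, Finset.mem_range, id] at hi hmax
    refine ⟨i, hmem.mpr ⟨hi.2, hp, fun j hj hpj => ?_⟩⟩
    have hjL : j < L.length + 1 := by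
      by_contra h
      rw [hflt j (by omega)] at hpj; simp at hpj
    have := hmax j ⟨hjL, hpj⟩
    omega

/-! ### Ghosting in terms of the encoding -/

lemma le_stabIndex_iff (hi : 1 ≤ i) :
    i ≤ σ.stabIndex S ↔ ∃ k, i ≤ k ∧ ¬ σ.R k ⊆ S ∪ σ.ghosts := by
  rw [stabIndex, Finset.le_sup_iff (show (⊥ : ℕ) < i from hi)]
  constructor
  · rintro ⟨k, hk, hik⟩
    exact ⟨k, hik, (Finset.mem_filter.mp hk).2⟩
  · rintro ⟨k, hik, hk⟩
    refine ⟨k, Finset.mem_filter.mpr ⟨?_, hk⟩, hik⟩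
    rw [Finset.mem_range]
    by_contra h
    rw [R_of_lt (by omega)] at hk
    simp at hk

lemma stabIndex_le : σ.stabIndex S ≤ σ.t :=
  Finset.sup_le fun i hi => by
    have := (Finset.mem_filter.mp hi).1
    rw [Finset.mem_range] at this
    exact Nat.lt_succ_iff.mp this

lemma R_stabilize (hi : i ≤ σ.stabIndex S) : (σ.stabilize S).R i = σ.R i := by
  ext p
  show p ∈ σ.stabW S i ∪ σ.stabG S i ↔ _
  rw [Finset.mem_union, mem_stabW]
  have := @mem_stabG σ S i p
  tauto

/-- A column of the stabilization keeps an upper part iff it contains an active process or a ghost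
that recurs before truncation. The shift arises because list position `i` holds `R (i + 1)`. -/
lemma succ_mem_steps_stabilize :
    i + 1 ∈ (σ.stabilize S).steps ↔ Survives (S ∪ σ.ghosts) σ.rounds i := by
  have h1 : i + 1 ∈ (σ.stabilize S).steps ↔
      i + 1 ≤ σ.stabIndex S ∧ (σ.stabW S (i + 1)).Nonempty := by
    rw [steps, Finset.mem_filter, Finset.mem_Icc]
    simp [stabilize]
  rw [h1, survives_iff]
  simp only [getD_rounds]
  constructor
  · rintro ⟨h2, p, hp⟩
    obtain ⟨-, h3, h4⟩ := mem_stabW.mp hp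
    refine ⟨p, h3, ?_⟩
    by_contra! h5
    refine h4 (mem_stabG.mpr ⟨h2, h3, h5.1, fun j hij hj hpj => ?_⟩)
    obtain ⟨k, hjk, hk⟩ := (le_stabIndex_iff (by omega)).mp hj
    refine hk ?_
    have := h5.2 (j - 1) (k - 1) (by omega) (by omega)
    rw [Nat.sub_add_cancel (by omega), Nat.sub_add_cancel (by omega)] at this
    exact this hpj
  · rintro ⟨p, hp, hor⟩
    have h2 : i + 1 ≤ σ.stabIndex S := by
      rw [le_stabIndex_iff (by omega)]
      rcases hor with h | ⟨j, k, h, h', -, hk⟩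
      · exact ⟨i + 1, le_rfl, fun hs => h (hs hp)⟩
      · exact ⟨k + 1, by omega, hk⟩
    refine ⟨h2, p, mem_stabW.mpr ⟨h2, hp, fun hG => ?_⟩⟩
    obtain ⟨-, -, h3, h4⟩ := mem_stabG.mp hG
    rcases hor with h | ⟨j, k, h, h', hj, hk⟩
    · exact h h3
    · refine h4 (j + 1) (by omega) ?_ hj
      exact (le_stabIndex_iff (by omega)).mpr ⟨k + 1, by omega, hk⟩

lemma mem_steps_stabilize_pos {j : ℕ} (h : j ∈ (σ.stabilize S).steps) :
    1 ≤ j ∧ j ≤ σ.stabIndex S := by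
  simpa [stabilize] using (Finset.mem_filter.mp h).1

open Classical in
lemma card_steps_lt :
    ((σ.stabilize S).steps.filter (· < i + 1)).card =
      Nat.count (Survives (S ∪ σ.ghosts) σ.rounds) i := by
  rw [Nat.count_eq_card_filter_range]
  symm
  refine Finset.card_bij (fun j _ => j + 1) ?_ ?_ ?_
  · intro j hj
    rw [Finset.mem_filter, Finset.mem_range] at hj
    exact Finset.mem_filter.mpr ⟨succ_mem_steps_stabilize.mpr hj.2, by omega⟩
  · intro a _ b _ h; simpa using h
  · intro j hj
    rw [Finset.mem_filter] at hj
    have := (mem_steps_stabilize_pos hj.1).1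
    obtain ⟨j, rfl⟩ : ∃ k, j = k + 1 := ⟨j - 1, by omega⟩
    exact ⟨j, Finset.mem_filter.mpr ⟨Finset.mem_range.mpr (by omega),
      succ_mem_steps_stabilize.mp hj.1⟩, rfl⟩

open Classical in
lemma card_steps :
    (σ.stabilize S).steps.card = Nat.count (Survives (S ∪ σ.ghosts) σ.rounds) σ.t := by
  rw [← card_steps_lt, Finset.filter_true_of_mem]
  intro j hj
  have := (mem_steps_stabilize_pos hj).2
  have := stabIndex_le (σ := σ) (S := S)
  omega

open Classical in
lemma slot_succ :
    (σ.stabilize S).slot (i + 1) = Nat.count (Survives (S ∪ σ.ghosts) σ.rounds) i + 1 := by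
  rw [slot, if_neg (by omega), card_steps_lt]

lemma supp_ghost : (ghost S σ).supp = σ.supp := by
  ext p
  show p ∈ (σ.stabilize S).mergeColumn (σ.stabilize S).W 0 ∪
    (σ.stabilize S).mergeColumn (σ.stabilize S).G 0 ↔ _
  rw [← show σ.R 0 = σ.supp from rfl, ← R_stabilize (Nat.zero_le (σ.stabIndex S)), R,
    Finset.mem_union, Finset.mem_union]
  simp [mem_mergeColumn, slot_eq_zero]

lemma ghosts_ghost (hS : S ⊆ σ.supp) : (ghost S σ).ghosts = S ∪ σ.ghosts := by
  ext p
  rw [mem_ghosts]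
  constructor
  · rintro ⟨k, hk⟩
    obtain ⟨-, i, -, -, hp⟩ := mem_mergeColumn.mp hk
    exact (mem_stabG.mp hp).2.2.1
  · intro hp
    obtain ⟨i, hi, hmax⟩ := Finset.exists_max_image
      ((range (σ.stabIndex S + 1)).filter fun i => p ∈ σ.R i) id
      ⟨0, by simpa [R] using Finset.mem_union.mp (Finset.union_subset hS σ.ghosts_subset_supp hp)⟩
    simp only [Finset.mem_filter, Finset.mem_range, id] at hi hmax
    have hG : p ∈ σ.stabG S i := mem_stabG.mpr ⟨by omega, hi.2, hp, fun j h1 h2 h3 => by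
      have := hmax j ⟨by omega, h3⟩
      omega⟩
    refine ⟨_, mem_mergeColumn.mpr ⟨?_, i, by simp only [stabilize]; omega, rfl, hG⟩⟩
    cases i with
    | zero => rw [slot_eq_zero.mpr rfl]; exact Nat.zero_le _
    | succ i =>
      rw [slot, if_neg (by omega)]
      refine Nat.succ_le_of_lt (Finset.card_lt_card ?_)
      -- The truncation index is itself a nonempty step, as its column contains a process that stays
      -- active, so the slot of any earlier column is within range.
      refine Finset.filter_ssubset.mpr ⟨σ.stabIndex S, ?_, by omega⟩
      obtain ⟨q, hq⟩ : ∃ q, σ.stabIndex S = q + 1 := ⟨σ.stabIndex S - 1, by omega⟩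
      obtain ⟨k, hk1, hk2⟩ := (le_stabIndex_iff (σ := σ) (S := S) (i := q + 1) (by omega)).mp hq.ge
      have hk3 : k ≤ q + 1 := by
        rw [← hq, le_stabIndex_iff (by omega)]; exact ⟨k, le_rfl, hk2⟩
      obtain rfl : k = q + 1 := by omega
      rw [hq, succ_mem_steps_stabilize, survives_iff]
      obtain ⟨a, ha, ha'⟩ := Finset.not_subset.mp hk2
      exact ⟨a, by rwa [getD_rounds], Or.inl ha'⟩

lemma rounds_ghost : (ghost S σ).rounds = norm (S ∪ σ.ghosts) σ.rounds := by
  classical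
  have hlen : (ghost S σ).rounds.length = (norm (S ∪ σ.ghosts) σ.rounds).length := by
    rw [length_rounds, length_norm, length_rounds]
    exact card_steps
  refine List.ext_getElem hlen fun k h1 h2 => ?_
  rw [← List.getD_eq_getElem _ ∅ h1, ← List.getD_eq_getElem _ ∅ h2]
  ext p
  rw [mem_getD_norm h2, getD_rounds]
  simp only [getD_rounds, length_rounds]
  rw [length_norm, length_rounds] at h2
  show p ∈ (σ.stabilize S).mergeColumn (σ.stabilize S).W (k + 1) ∪
    (σ.stabilize S).mergeColumn (σ.stabilize S).G (k + 1) ↔ _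
  rw [Finset.mem_union, mem_mergeColumn, mem_mergeColumn, card_steps]
  have hk : k + 1 ≤ Nat.count (Survives (S ∪ σ.ghosts) σ.rounds) σ.t := h2
  simp only [hk, true_and]
  constructor
  · intro h
    obtain ⟨i, hi, hs, hp⟩ : ∃ i ≤ σ.stabIndex S, (σ.stabilize S).slot i = k + 1 ∧
        p ∈ (σ.stabilize S).R i := by
      rcases h with ⟨i, h1, h2, h3⟩ | ⟨i, h1, h2, h3⟩
      · exact ⟨i, h1, h2, Finset.mem_union_left _ h3⟩
      · exact ⟨i, h1, h2, Finset.mem_union_right _ h3⟩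
    rw [R_stabilize hi] at hp
    cases i with
    | zero => rw [slot_eq_zero.mpr rfl] at hs; omega
    | succ i =>
      rw [slot_succ] at hs
      have := stabIndex_le (σ := σ) (S := S)
      exact ⟨i, by omega, by omega, hp⟩
  · rintro ⟨i, hi, hs, hp⟩
    -- Beyond the truncation index all survivors have been passed, so the count would equal the
    -- total, which exceeds `k`.
    have hq : i + 1 ≤ σ.stabIndex S := by
      by_contra hlt
      have : Nat.count (Survives (S ∪ σ.ghosts) σ.rounds) i =
          Nat.count (Survives (S ∪ σ.ghosts) σ.rounds) σ.t := by
        rw [Nat.count_eq_card_filter_range, Nat.count_eq_card_filter_range]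
        congr 1
        ext j
        simp only [Finset.mem_filter, Finset.mem_range]
        refine and_congr_left fun hj => ?_
        have := (mem_steps_stabilize_pos (succ_mem_steps_stabilize.mpr hj)).2
        omega
      omega
    rw [← R_stabilize hq, R, Finset.mem_union] at hp
    rcases hp with hp | hp
    · exact Or.inl ⟨i + 1, hq, by rw [slot_succ, hs], hp⟩
    · exact Or.inr ⟨i + 1, hq, by rw [slot_succ, hs], hp⟩

lemma encode_ghost (hS : S ⊆ σ.supp) :
    (ghost S σ).encode = (norm (S ∪ σ.ghosts) σ.rounds, S ∪ σ.ghosts) :=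
  Prod.ext rounds_ghost (ghosts_ghost hS)

end WitnessPrestructure

end ImmediateSnapshot

namespace ImmediateSnapshot

/-! ### Cofaces of codimension one -/

variable {U F D : Finset ℕ} {r : ℕ → ℕ} {x y z : List (Finset ℕ) × Finset ℕ} {q : ℕ}

lemma FaceLE.antisymm (hx : IsNormal x.2 x.1) (hxy : FaceLE x y) (hyx : FaceLE y x) : x = y := by
  have h2 : x.2 = y.2 := Finset.Subset.antisymm hyx.1 hxy.1
  refine Prod.ext ?_ h2
  rw [hyx.2, ← h2, hx.norm_eq]

lemma occ_replicate (a b k : ℕ) : occ a (List.replicate k {b}) = if a = b then k else 0 := by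
  induction k with
  | zero => simp [occ]
  | succ k ih =>
    rw [List.replicate_succ, occ, ih]
    by_cases h : a = b <;> simp [h, add_comm]

lemma unionOf_replicate_subset (b k : ℕ) : unionOf (List.replicate k {b}) ⊆ {b} := fun a ha => by
  obtain ⟨S, hS, ha⟩ := mem_unionOf.mp ha
  rwa [List.eq_of_mem_replicate hS] at ha

/-- Solo rounds suffice: each `a ∈ A` runs alone `m a` times. -/
lemma exists_list_occ_eq (A : Finset ℕ) (m : ℕ → ℕ) :
    ∃ K : List (Finset ℕ), (∀ T ∈ K, T.Nonempty) ∧ unionOf K ⊆ A ∧ ∀ a ∈ A, occ a K = m a := by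
  induction A using Finset.induction_on with
  | empty => exact ⟨[], by simp, by simp [unionOf], by simp⟩
  | insert b A hb ih =>
    obtain ⟨K, h1, h2, h3⟩ := ih
    refine ⟨List.replicate (m b) {b} ++ K, ?_, ?_, ?_⟩
    · intro T hT
      rcases List.mem_append.mp hT with h | h
      · rw [List.eq_of_mem_replicate h]; simp
      · exact h1 T h
    · rw [unionOf_append, Finset.insert_eq]
      exact Finset.union_subset_union (unionOf_replicate_subset _ _) h2
    · intro a ha
      rw [occ_append, occ_replicate]
      rcases Finset.mem_insert.mp ha with rfl | haA
      · have : occ a K = 0 := occ_eq_zero.mpr fun h => hb (h2 h)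
        simp [this]
      · have : a ≠ b := by rintro rfl; exact hb haA
        simp [this, h3 a haA]

lemma subset_initialGhosts_iff : F ⊆ initialGhosts x ↔ F ⊆ x.2 ∧ Disjoint F (unionOf x.1) :=
  Finset.subset_sdiff

/-- The ghosts outside `F` are revived by appending their missing rounds at the end; ghosting them
again erases exactly this tail. -/
lemma IsConfig.exists_coface (hx : IsConfig U r x) (hF : F ⊆ initialGhosts x) :
    ∃ y, IsConfig U r y ∧ y.2 = F ∧ F ⊆ initialGhosts y ∧ FaceLE x y := by
  obtain ⟨hFx, hFd⟩ := subset_initialGhosts_iff.mp hF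
  obtain ⟨K, h1, h2, h3⟩ := exists_list_occ_eq (x.2 \ F) fun a => r a - occ a x.1
  have hd : Disjoint F (unionOf (x.1 ++ K)) := by
    rw [unionOf_append, Finset.disjoint_union_right]
    exact ⟨hFd, Finset.disjoint_sdiff.mono_right h2⟩
  have hocc : ∀ a ∈ U, a ∉ F → occ a (x.1 ++ K) = r a := by
    intro a ha haF
    rw [occ_append]
    by_cases hax : a ∈ x.2
    · rw [h3 a (Finset.mem_sdiff.mpr ⟨hax, haF⟩)]
      have := hx.occ_le a ha
      omega
    · rw [hx.occ_eq a ha hax, occ_eq_zero.mpr fun h => hax (Finset.mem_sdiff.mp (h2 h)).1]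
      omega
  refine ⟨(x.1 ++ K, F), ⟨?_, hFx.trans hx.ghosts_subset, ?_, ?_, hocc⟩, rfl,
    subset_initialGhosts_iff.mpr ⟨le_rfl, hd⟩, hFx, ?_⟩
  · refine isNormal_of_disjoint (fun S hS => ?_) hd
    rcases List.mem_append.mp hS with h | h
    · exact hx.normal.nonempty S h
    · exact h1 S h
  · rw [unionOf_append]
    exact Finset.union_subset hx.rounds_subset (h2.trans (sdiff_subset.trans hx.ghosts_subset))
  · intro a ha
    by_cases haF : a ∈ F
    · rw [occ_eq_zero.mpr (Finset.disjoint_left.mp hd haF)]; exact Nat.zero_le _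
    · exact (hocc a ha haF).le
  · rw [norm_append (h2.trans sdiff_subset), hx.normal.norm_eq]

lemma eq_singleton_of_subset_insert {S : Finset ℕ} (hne : S.Nonempty) (hd : Disjoint F S)
    (h : S ⊆ insert q F) : S = {q} := by
  refine (Finset.eq_singleton_iff_nonempty_unique_mem).mpr ⟨hne, fun a ha => ?_⟩
  exact (Finset.mem_insert.mp (h ha)).resolve_right fun haF => Finset.disjoint_left.mp hd haF ha

/-- With `F` absent from the rounds, only rounds equal to `{q}` can be merged or dropped. A merge
would leave `q` visible, so only trailing copies of `{q}` disappear. -/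
lemma eq_norm_append_replicate {M : List (Finset ℕ)} (hne : ∀ S ∈ M, S.Nonempty)
    (hd : Disjoint F (unionOf M)) (hq : q ∉ unionOf (norm (insert q F) M)) :
    ∃ k, M = norm (insert q F) M ++ List.replicate k {q} := by
  induction M with
  | nil => exact ⟨0, rfl⟩
  | cons S M ih =>
    rw [unionOf, Finset.disjoint_union_right] at hd
    obtain ⟨k, hk⟩ := ih (fun T hT => hne T (List.mem_cons_of_mem _ hT)) hd.2
      fun h => hq (subset_unionOf_push _ _ _ h)
    rw [norm] at hq ⊢
    generalize norm (insert q F) M = N at hq hk ⊢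
    have hS := eq_singleton_of_subset_insert (q := q) (hne S (by simp)) hd.1
    rcases push_cases (insert q F) S N with ⟨-, h⟩ | ⟨hs, rfl, h⟩ | ⟨T, N', rfl, hs, -, -, h⟩ <;>
      rw [h] at hq ⊢
    · exact ⟨k, by rw [hk, List.cons_append]⟩
    · refine ⟨k + 1, ?_⟩
      rw [hk, hS hs, List.replicate_succ]
      rfl
    · rw [hS hs] at hq
      simp [unionOf] at hq

lemma IsConfig.coface_unique (hqU : q ∈ U) (hqF : q ∉ F) (hq : q ∉ unionOf y.1)
    (hy : y.2 = insert q F) {z z' : List (Finset ℕ) × Finset ℕ}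
    (hz : IsConfig U r z) (hzF : z.2 = F) (hFz : F ⊆ initialGhosts z) (hyz : FaceLE y z)
    (hz' : IsConfig U r z') (hzF' : z'.2 = F) (hFz' : F ⊆ initialGhosts z') (hyz' : FaceLE y z') :
    z = z' := by
  have key : ∀ {z}, IsConfig U r z → z.2 = F → F ⊆ initialGhosts z → FaceLE y z →
      z = (y.1 ++ List.replicate (r q) {q}, F) := by
    intro z hz hzF hFz hyz
    have h2 : y.1 = norm (insert q F) z.1 := hyz.2.trans (by rw [hy])
    obtain ⟨k, hk⟩ := eq_norm_append_replicate hz.normal.nonempty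
      (subset_initialGhosts_iff.mp hFz).2 (by rwa [← h2])
    rw [← h2] at hk
    have := hz.occ_eq q hqU (by rwa [hzF])
    rw [hk, occ_append, occ_eq_zero.mpr hq, occ_replicate] at this
    simp at this
    rw [← this]
    exact Prod.ext hk hzF
  rw [key hz hzF hFz hyz, key hz' hzF' hFz' hyz']

lemma exists_last_occurrence {L : List (Finset ℕ)} (h : q ∈ unionOf L) :
    ∃ L₁ S L₂, L = L₁ ++ S :: L₂ ∧ q ∈ S ∧ q ∉ unionOf L₂ := by
  induction L with
  | nil => simp [unionOf] at h
  | cons S L ih =>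
    by_cases hL : q ∈ unionOf L
    · obtain ⟨L₁, T, L₂, rfl, h1, h2⟩ := ih hL
      exact ⟨S :: L₁, T, L₂, rfl, h1, h2⟩
    · rw [unionOf, Finset.mem_union] at h
      exact ⟨[], S, L, rfl, h.resolve_right hL, hL⟩

lemma IsNormal.of_append {L M : List (Finset ℕ)} (h : IsNormal D (L ++ M)) : IsNormal D M := by
  induction L with
  | nil => exact h
  | cons S L ih => exact ih h.2

lemma norm_append_congr {L M N : List (Finset ℕ)} (h : norm D M = norm D N) :
    norm D (L ++ M) = norm D (L ++ N) := by
  induction L with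
  | nil => exact h
  | cons S L ih => rw [List.cons_append, List.cons_append, norm, norm, ih]

/-- At its last visible occurrence, in `S`, the process `q` may have run together with `S \ {q}` or
alone just before it; ghosting `q` hides the difference. Its missing rounds are appended in both
cases. -/
lemma IsConfig.exists_two_cofaces (hy : IsConfig U r y) (hqF : q ∉ F) (hyF : y.2 = insert q F)
    (hF : F ⊆ initialGhosts y) (hq : q ∈ unionOf y.1) :
    ∃ z z', z ≠ z' ∧
      (IsConfig U r z ∧ z.2 = F ∧ F ⊆ initialGhosts z ∧ FaceLE y z) ∧
      (IsConfig U r z' ∧ z'.2 = F ∧ F ⊆ initialGhosts z' ∧ FaceLE y z') := by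
  obtain ⟨L, E⟩ := y
  obtain rfl : E = insert q F := hyF
  have hqU : q ∈ U := hy.rounds_subset hq
  obtain ⟨L₁, S, L₂, rfl, hqS, hqL⟩ := exists_last_occurrence hq
  have hd : Disjoint F (unionOf (L₁ ++ S :: L₂)) := (subset_initialGhosts_iff.mp hF).2
  have hnS : IsNormal (insert q F) (S :: L₂) := hy.normal.of_append
  have hdS : Disjoint F S := by
    rw [unionOf_append, unionOf, Finset.disjoint_union_right, Finset.disjoint_union_right] at hd
    exact hd.2.1
  have hS' : ¬ S \ {q} ⊆ insert q F := by
    intro hs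
    have : S = {q} := by
      refine eq_singleton_of_subset_insert ⟨q, hqS⟩ hdS fun a ha => ?_
      by_cases haq : a = q
      · rw [haq]; exact Finset.mem_insert_self _ _
      · exact hs (by simp [ha, haq])
    subst this
    exact hnS.1 (by simp [hqL])
  have hSq : {q} ∪ S \ {q} = S := Finset.union_sdiff_of_subset (by simpa using hqS)
  have mk : ∀ N : List (Finset ℕ), (∀ T ∈ N, T.Nonempty) →
      unionOf N = unionOf (L₁ ++ S :: L₂) → (∀ a, occ a N = occ a (L₁ ++ S :: L₂)) →
      norm (insert q F) N = L₁ ++ S :: L₂ →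
      IsConfig U r (N ++ List.replicate (r q - occ q (L₁ ++ S :: L₂)) {q}, F) ∧
        F ⊆ initialGhosts (N ++ List.replicate (r q - occ q (L₁ ++ S :: L₂)) {q}, F) ∧
        FaceLE (L₁ ++ S :: L₂, insert q F)
          (N ++ List.replicate (r q - occ q (L₁ ++ S :: L₂)) {q}, F) := by
    intro N hN hU hocc hnorm
    set rep : List (Finset ℕ) := List.replicate (r q - occ q (L₁ ++ S :: L₂)) {q} with hrep
    have hur : unionOf rep ⊆ {q} := unionOf_replicate_subset _ _
    have hd' : Disjoint F (unionOf (N ++ rep)) := by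
      rw [unionOf_append, hU, Finset.disjoint_union_right]
      exact ⟨hd, (Finset.disjoint_singleton_right.mpr hqF).mono_right hur⟩
    have hocc' : ∀ a ∈ U, a ∉ F → occ a (N ++ rep) = r a := by
      intro a ha haF
      rw [occ_append, hocc, hrep, occ_replicate]
      have h5 : occ a (L₁ ++ S :: L₂) ≤ r a := hy.occ_le a ha
      split_ifs with haq
      · subst haq; omega
      · exact hy.occ_eq a ha (by simp [haq, haF])
    refine ⟨⟨?_, ?_, ?_, ?_, hocc'⟩, subset_initialGhosts_iff.mpr ⟨le_rfl, hd'⟩,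
      ⟨Finset.subset_insert _ _, ?_⟩⟩
    · refine isNormal_of_disjoint (fun T hT => ?_) hd'
      rcases List.mem_append.mp hT with h | h
      · exact hN T h
      · rw [List.eq_of_mem_replicate h]; simp
    · exact (Finset.subset_insert _ _).trans hy.ghosts_subset
    · rw [unionOf_append, hU]
      exact Finset.union_subset hy.rounds_subset (hur.trans (by simpa using hqU))
    · intro a ha
      by_cases haF : a ∈ F
      · rw [occ_eq_zero.mpr (Finset.disjoint_left.mp hd' haF)]; exact Nat.zero_le _
      · exact (hocc' a ha haF).le
    · rw [norm_append (hur.trans (by simp)), hnorm]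
  obtain ⟨h5, h6, h7⟩ := mk (L₁ ++ S :: L₂) hy.normal.nonempty rfl (fun _ => rfl)
    hy.normal.norm_eq
  obtain ⟨h5', h6', h7'⟩ := mk (L₁ ++ {q} :: (S \ {q}) :: L₂) (by
      have := hy.normal.nonempty
      simp only [List.mem_append, List.mem_cons] at this ⊢
      rintro T (h | rfl | rfl | h)
      · exact this T (Or.inl h)
      · simp
      · rw [Finset.nonempty_iff_ne_empty]
        intro h; apply hS'; rw [h]; simp
      · exact this T (Or.inr (Or.inr h)))
    (by
      rw [unionOf_append, unionOf_append, unionOf, unionOf, unionOf, ← Finset.union_assoc {q}, hSq])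
    (fun a => by
      rw [occ_append, occ_append, occ, occ, occ]
      by_cases haq : a = q
      · subst haq; simp [hqS]
      · simp [haq])
    (by
      rw [norm_append_congr (N := S :: L₂)]
      · exact hy.normal.norm_eq
      · have h8 : norm (insert q F) L₂ = L₂ := hnS.2.norm_eq
        rw [norm, norm, norm, h8, push_of_not_subset hnS.1,
          push_of_not_subset fun h => hS' (h.trans sdiff_subset), push_cons, hSq]
        simp [unionOf, hqL])
  refine ⟨_, _, ?_, ⟨h5, rfl, h6, h7⟩, ⟨h5', rfl, h6', h7'⟩⟩
  intro h
  have := congrArg List.length (Prod.mk.inj h).1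
  -- The split list has exactly one round more.
  simp at this

/-! ### The boundary -/

/-- The top simplices have ghost set `F`. A ridge with ghost set `insert q F` lies in exactly one of
them iff `q` occurs in none of its rounds. A general `F` covers both the whole complex (`F = ∅`) and
`B_p` (`F = {p}`). -/
theorem boundary_image_configs {β : Type*} (φ : List (Finset ℕ) × Finset ℕ → Finset β)
    (hle : ∀ x, IsConfig U r x → ∀ y, IsConfig U r y → (φ x ⊆ φ y ↔ FaceLE x y))
    (hcard : ∀ x, IsConfig U r x → (φ x).card = (U \ x.2).card) (hF : F ⊆ U)
    (hlower : IsLowerSet (φ '' {x | IsConfig U r x ∧ F ⊆ initialGhosts x})) :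
    boundary (φ '' {x | IsConfig U r x ∧ F ⊆ initialGhosts x}) =
      φ '' {x | IsConfig U r x ∧ F ⊆ initialGhosts x ∧ initialGhosts x ≠ F} := by
  set K := φ '' {x | IsConfig U r x ∧ F ⊆ initialGhosts x} with hK
  have hcard' : ∀ x, IsConfig U r x → (φ x).card + x.2.card = U.card := fun x hx => by
    rw [hcard x hx, Finset.card_sdiff_add_card_eq_card hx.ghosts_subset]
  have hFx : ∀ {x}, F ⊆ initialGhosts x → F ⊆ x.2 := fun h => (subset_initialGhosts_iff.mp h).1
  have hinj : ∀ x, IsConfig U r x → ∀ y, IsConfig U r y → φ x = φ y → x = y :=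
    fun x hx y hy h => ((hle x hx y hy).mp h.subset).antisymm hx.normal
      ((hle y hy x hx).mp h.superset)
  have htop : ∀ z, IsConfig U r z → F ⊆ initialGhosts z → (IsTopSimplex K (φ z) ↔ z.2 = F) := by
    intro z hz hzF
    constructor
    · rintro ⟨-, h⟩
      -- This pair encodes the empty simplex; a coface of it with ghost set `F` provides the maximal
      -- dimension.
      have hU : IsConfig U r ([], U) :=
        ⟨trivial, le_rfl, by simp [unionOf], by simp [occ], fun a h1 h2 => absurd h1 h2⟩
      obtain ⟨w, hw, hw2, hwF, -⟩ := hU.exists_coface (F := F) (by simpa [initialGhosts, unionOf])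
      have h1 := h _ ⟨w, ⟨hw, hwF⟩, rfl⟩
      have h2 := hcard' w hw
      have h3 := hcard' z hz
      rw [hw2] at h2
      exact (Finset.eq_of_subset_of_card_le (hFx hzF) (by omega)).symm
    · rintro h
      refine ⟨⟨z, ⟨hz, hzF⟩, rfl⟩, ?_⟩
      rintro _ ⟨x, ⟨hx, hxF⟩, rfl⟩
      have h1 := hcard' x hx
      have h2 := hcard' z hz
      have h3 := Finset.card_le_card (hFx hxF)
      rw [h] at h2
      omega
  ext s
  constructor
  · rintro ⟨_, ⟨y, ⟨hy, hyF⟩, rfl⟩, hsy, ρ, ⟨hρ, hyρ, hyc⟩, huniq⟩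
    obtain ⟨z, ⟨hz, hzF⟩, rfl⟩ := hρ.1
    have hz2 := (htop z hz hzF).mp hρ
    have h1 := hcard' y hy
    have h2 := hcard' z hz
    rw [hz2] at h2
    obtain ⟨q, hqF, hqy⟩ := Finset.exists_eq_insert_iff.mpr ⟨hFx hyF, (by omega : F.card + 1 = _)⟩
    have hc : ∀ w, IsConfig U r w → w.2 = F → (φ y).card + 1 = (φ w).card := fun w hw hwF => by
      have := hcard' w hw
      rw [hwF] at this; omega
    have hq : q ∈ initialGhosts y := by
      refine Finset.mem_sdiff.mpr ⟨hqy ▸ Finset.mem_insert_self _ _, fun hq => ?_⟩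
      obtain ⟨w, w', hne, ⟨a1, a2, a3, a4⟩, ⟨b1, b2, b3, b4⟩⟩ :=
        hy.exists_two_cofaces hqF hqy.symm hyF hq
      refine hne (hinj w a1 w' b1 ?_)
      rw [huniq (φ w) ⟨(htop w a1 a3).mpr a2, (hle y hy w a1).mpr a4, hc w a1 a2⟩,
        huniq (φ w') ⟨(htop w' b1 b3).mpr b2, (hle y hy w' b1).mpr b4, hc w' b1 b2⟩]
    obtain ⟨x, ⟨hx, hxF⟩, rfl⟩ := hlower hsy ⟨y, ⟨hy, hyF⟩, rfl⟩
    -- The initial ghost `q` of the ridge is inherited by every face of it.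
    refine ⟨x, ⟨hx, hxF, fun h => hqF ?_⟩, rfl⟩
    rw [← h]
    exact ((hle x hx y hy).mp hsy).initialGhosts_subset hq
  · rintro ⟨x, ⟨hx, hxF, hne⟩, rfl⟩
    obtain ⟨q, hq, hqF⟩ := Finset.exists_of_ssubset (hxF.ssubset_of_ne hne.symm)
    obtain ⟨y, hy, hy2, hyF, hxy⟩ := hx.exists_coface (Finset.insert_subset hq hxF)
    have hFy : F ⊆ initialGhosts y := (Finset.subset_insert _ _).trans hyF
    have hqy := Finset.mem_sdiff.mp (hyF (Finset.mem_insert_self q F))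
    obtain ⟨z, hz, hz2, hzF, hyz⟩ := hy.exists_coface hFy
    refine ⟨φ y, ⟨y, ⟨hy, hFy⟩, rfl⟩, (hle x hx y hy).mpr hxy, φ z,
      ⟨(htop z hz hzF).mpr hz2, (hle y hy z hz).mpr hyz, ?_⟩, ?_⟩
    · have h1 := hcard' y hy
      have h2 := hcard' z hz
      rw [hy2, Finset.card_insert_of_notMem hqF] at h1
      rw [hz2] at h2
      omega
    · rintro ρ ⟨hρ, hyρ, -⟩
      obtain ⟨w, ⟨hw, hwF⟩, rfl⟩ := hρ.1
      rw [IsConfig.coface_unique (hy.ghosts_subset hqy.1) hqF hqy.2 hy2 hw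
        ((htop w hw hwF).mp hρ) hwF ((hle y hy w hw).mp hyρ) hz hz2 hzF hyz]

end ImmediateSnapshot

namespace ImmediateSnapshot

/-! ### The immediate snapshot complex -/

/-- The number of rounds of a process, with value `0` outside the support. -/
def RoundCounter.rounds (r : RoundCounter) (p : ℕ) : ℕ := (r.toFun p).unbotD 0

lemma RoundCounter.toFun_eq {r : RoundCounter} {p : ℕ} (hp : p ∈ r.supp) :
    r.toFun p = (r.rounds p : WithBot ℕ) := by
  have : r.toFun p ≠ ⊥ := by simpa [RoundCounter.supp] using hp
  obtain ⟨k, hk⟩ := WithBot.ne_bot_iff_exists.mp this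
  rw [RoundCounter.rounds, ← hk]; rfl

open WitnessPrestructure

variable {r : RoundCounter} {σ τ w : WitnessPrestructure}

lemma mem_simplexIndices :
    σ ∈ simplexIndices r ↔ σ.supp = r.supp ∧ IsConfig r.supp r.rounds σ.encode := by
  have hM : ∀ p, p ∈ σ.supp → σ.supp = r.supp →
      ((((σ.M p : ℕ) : WithBot ℕ) = r.toFun p + 1 ↔ occ p σ.rounds = r.rounds p) ∧
      (((σ.M p : ℕ) : WithBot ℕ) ≤ r.toFun p + 1 ↔ occ p σ.rounds ≤ r.rounds p)) := by
    intro p hp hs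
    rw [M_eq hp, RoundCounter.toFun_eq (hs ▸ hp)]
    constructor <;> norm_cast <;> omega
  constructor
  · rintro ⟨h1, h2, h3, h4⟩
    have h3' : ∀ p ∈ r.supp, p ∉ σ.ghosts → occ p σ.rounds = r.rounds p := fun p hp hg =>
      (hM p (h2 ▸ hp) h2).1.mp (h3 p (Finset.mem_sdiff.mpr ⟨h2 ▸ hp, hg⟩))
    refine ⟨h2, isNormal_encode.mpr h1, h2 ▸ σ.ghosts_subset_supp, ?_, ?_, h3'⟩
    · intro p hp
      obtain ⟨i, hi⟩ := mem_unionOf_rounds.mp hp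
      exact h2 ▸ σ.R_subset_supp _ hi
    · intro p hp
      by_cases hg : p ∈ σ.ghosts
      · exact (hM p (h2 ▸ hp) h2).2.mp (h4 p hg)
      · exact (h3' p hp hg).le
  · rintro ⟨h2, h⟩
    refine ⟨isNormal_encode.mp h.normal, h2, fun p hp => ?_, fun p hp => ?_⟩
    · obtain ⟨h5, h6⟩ := Finset.mem_sdiff.mp hp
      exact (hM p h5 h2).1.mpr (h.occ_eq p (h2 ▸ h5) h6)
    · have h5 := σ.ghosts_subset_supp hp
      exact (hM p h5 h2).2.mpr (h.occ_le p (h2 ▸ h5))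

lemma exists_mem_simplexIndices {x : List (Finset ℕ) × Finset ℕ}
    (hx : IsConfig r.supp r.rounds x) : ∃ σ ∈ simplexIndices r, σ.encode = x := by
  obtain ⟨σ, h1, h2⟩ := exists_encode_eq hx.ghosts_subset hx.rounds_subset
  exact ⟨σ, mem_simplexIndices.mpr ⟨h1, h2.symm ▸ hx⟩, h2⟩

/-! ### Vertices and faces of a simplex -/

lemma encode_vertex {a : ℕ} (ha : a ∈ σ.active) :
    (ghost (σ.active \ {a}) σ).encode = (norm (σ.supp \ {a}) σ.rounds, σ.supp \ {a}) := by
  have h : σ.active \ {a} ∪ σ.ghosts = σ.supp \ {a} := by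
    ext p
    have h1 := @ghosts_subset_supp σ p
    have h2 := (Finset.mem_sdiff.mp ha).2
    simp only [active, Finset.mem_union, Finset.mem_sdiff, Finset.mem_singleton]
    constructor
    · rintro (h | h)
      · exact ⟨h.1.1, h.2⟩
      · exact ⟨h1 h, by rintro rfl; exact h2 h⟩
    · tauto
  have hS : σ.active \ {a} ⊆ σ.supp := sdiff_subset.trans sdiff_subset
  rw [encode_ghost hS, h]

lemma mem_vertices : w ∈ σ.vertices ↔ w.supp = σ.supp ∧
    ∃ a ∈ σ.active, w.encode = (norm (σ.supp \ {a}) σ.rounds, σ.supp \ {a}) := by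
  classical
  rw [vertices, Finset.mem_image]
  constructor
  · rintro ⟨a, ha, rfl⟩
    exact ⟨supp_ghost, a, ha, encode_vertex ha⟩
  · rintro ⟨h, a, ha, he⟩
    exact ⟨a, ha, encode_inj (supp_ghost.trans h.symm) ((encode_vertex ha).trans he.symm)⟩

lemma sdiff_singleton_inj {U : Finset ℕ} {a b : ℕ} (ha : a ∈ U) (h : U \ {a} = U \ {b}) :
    a = b := by
  by_contra hab
  have : a ∈ U \ {b} := by simp [ha, hab]
  rw [← h] at this
  simp at this

lemma card_vertices (σ : WitnessPrestructure) : σ.vertices.card = σ.active.card := by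
  classical
  refine Finset.card_image_of_injOn fun a ha b hb h => ?_
  have := congrArg encode h
  simp only [encode_vertex ha, encode_vertex hb] at this
  exact sdiff_singleton_inj (Finset.mem_sdiff.mp ha).1 (Prod.mk.inj this).2

/-- A vertex remembers its only active process, so an inclusion of vertex sets matches vertices by
name. Then `σ` and the face of `τ` with the ghosts of `σ` have the same vertex lists, and
`IsNormal.ext` identifies them. -/
lemma vertices_subset_iff (hσ : σ.IsWitnessStructure)
    (hs : σ.supp = τ.supp) : σ.vertices ⊆ τ.vertices ↔ FaceLE σ.encode τ.encode := by
  constructor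
  · intro h
    have key : ∀ a ∈ σ.active, a ∈ τ.active ∧
        norm (σ.supp \ {a}) σ.rounds = norm (σ.supp \ {a}) τ.rounds := by
      intro a ha
      obtain ⟨-, b, hb, he⟩ := mem_vertices.mp
        (h (mem_vertices.mpr ⟨supp_ghost, a, ha, encode_vertex ha⟩))
      rw [encode_vertex ha, ← hs] at he
      obtain ⟨h1, h2⟩ := Prod.mk.inj he
      obtain rfl := sdiff_singleton_inj (Finset.mem_sdiff.mp ha).1 h2
      exact ⟨hb, h1⟩
    have hg : τ.ghosts ⊆ σ.ghosts := by
      intro p hp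
      by_contra hpσ
      have hpa : p ∈ σ.active :=
        Finset.mem_sdiff.mpr ⟨hs ▸ τ.ghosts_subset_supp hp, hpσ⟩
      exact (Finset.mem_sdiff.mp (key p hpa).1).2 hp
    have hU : ∀ {τ : WitnessPrestructure}, unionOf τ.rounds ⊆ τ.supp := fun {τ} p hp => by
      obtain ⟨i, hi⟩ := mem_unionOf_rounds.mp hp
      exact τ.R_subset_supp _ hi
    refine ⟨hg, IsNormal.ext (isNormal_encode.mpr hσ) (isNormal_norm _ _) hU
      ((unionOf_norm_subset _ _).trans (hs ▸ hU)) fun a ha => ?_⟩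
    show norm _ σ.rounds = norm _ (norm σ.ghosts τ.rounds)
    rw [norm_norm, (key a ha).2]
    refine fun p hp => Finset.mem_sdiff.mpr ⟨σ.ghosts_subset_supp hp, fun h => ?_⟩
    rw [Finset.mem_singleton.mp h] at hp
    exact (Finset.mem_sdiff.mp ha).2 hp
  · rintro ⟨h1, h2⟩ w hw
    obtain ⟨h3, a, ha, he⟩ := mem_vertices.mp hw
    obtain ⟨ha1, ha2⟩ := Finset.mem_sdiff.mp ha
    refine mem_vertices.mpr ⟨h3.trans hs, a,
      Finset.mem_sdiff.mpr ⟨hs ▸ ha1, fun h => ha2 (h1 h)⟩, ?_⟩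
    change σ.rounds = norm σ.ghosts τ.rounds at h2
    rw [he, h2, norm_norm, hs]
    refine fun p hp => Finset.mem_sdiff.mpr ⟨σ.ghosts_subset_supp hp, fun h => ?_⟩
    rw [Finset.mem_singleton.mp h] at hp
    exact ha2 hp

theorem isLowerSet_complex (r : RoundCounter) : IsLowerSet (complex r) := by
  classical
  rintro _ s hs ⟨σ, hσ, rfl⟩
  obtain ⟨hsupp, hc⟩ := mem_simplexIndices.mp hσ
  -- The processes whose vertices lie in `s`; the required face is obtained by turning all the
  -- others into ghosts.
  set B := σ.active.filter fun a => ghost (σ.active \ {a}) σ ∈ s with hB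
  have hgB : σ.ghosts ⊆ r.supp \ B := fun p hp => Finset.mem_sdiff.mpr
    ⟨hc.ghosts_subset hp, fun h => (Finset.mem_sdiff.mp (Finset.mem_filter.mp h).1).2 hp⟩
  obtain ⟨τ, hτ, he⟩ := exists_mem_simplexIndices (hc.face hgB sdiff_subset)
  obtain ⟨he1, he2⟩ := Prod.mk.inj he
  have hτs := (mem_simplexIndices.mp hτ).1
  have hBr : B ⊆ r.supp := (Finset.filter_subset _ _).trans (hsupp ▸ sdiff_subset)
  have hact : τ.active = B := by rw [active, he2, hτs, Finset.sdiff_sdiff_eq_self hBr]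
  refine ⟨τ, hτ, ?_⟩
  ext w
  rw [mem_vertices, hact, hτs, he1]
  have hn : ∀ a ∈ B, norm (r.supp \ {a}) (norm (r.supp \ B) σ.rounds) =
      norm (r.supp \ {a}) σ.rounds := fun a ha =>
    norm_norm (Finset.sdiff_subset_sdiff le_rfl (by simpa using ha)) _
  constructor
  · rintro ⟨h1, a, ha, h2⟩
    obtain ⟨ha1, ha2⟩ := Finset.mem_filter.mp ha
    convert ha2
    refine encode_inj (h1.trans (supp_ghost.trans hsupp).symm) ?_
    rw [h2, encode_vertex ha1, hsupp]
    exact Prod.ext (hn a ha) rfl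
  · intro hw
    obtain ⟨h1, a, ha, h2⟩ := mem_vertices.mp (hs hw)
    have hwa : w = ghost (σ.active \ {a}) σ :=
      encode_inj (h1.trans supp_ghost.symm) (h2.trans (encode_vertex ha).symm)
    have haB : a ∈ B := Finset.mem_filter.mpr ⟨ha, hwa ▸ hw⟩
    refine ⟨h1.trans hsupp, a, haB, ?_⟩
    rw [h2, hsupp]
    exact Prod.ext (hn a haB).symm rfl

/-! ### Transport from pairs to simplices, and the collapses -/

open Classical in
/-- The simplex that is encoded by a pair. -/
noncomputable def simplexOf (r : RoundCounter) (x : List (Finset ℕ) × Finset ℕ) :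
    Finset WitnessPrestructure :=
  if h : ∃ σ ∈ simplexIndices r, σ.encode = x then h.choose.vertices else ∅

lemma simplexOf_encode (hσ : σ ∈ simplexIndices r) : simplexOf r σ.encode = σ.vertices := by
  have h : ∃ τ ∈ simplexIndices r, τ.encode = σ.encode := ⟨σ, hσ, rfl⟩
  rw [simplexOf, dif_pos h, encode_inj _ h.choose_spec.2]
  rw [h.choose_spec.1.2.1, hσ.2.1]

lemma simplexOf_subset_iff {x y : List (Finset ℕ) × Finset ℕ}
    (hx : IsConfig r.supp r.rounds x) (hy : IsConfig r.supp r.rounds y) :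
    simplexOf r x ⊆ simplexOf r y ↔ FaceLE x y := by
  obtain ⟨σ, hσ, rfl⟩ := exists_mem_simplexIndices hx
  obtain ⟨τ, hτ, rfl⟩ := exists_mem_simplexIndices hy
  rw [simplexOf_encode hσ, simplexOf_encode hτ,
    vertices_subset_iff hσ.1 (hσ.2.1.trans hτ.2.1.symm)]

lemma simplexOf_injOn : Set.InjOn (simplexOf r) {x | IsConfig r.supp r.rounds x} :=
  fun _ hx _ hy h => ((simplexOf_subset_iff hx hy).mp h.subset).antisymm hx.normal
    ((simplexOf_subset_iff hy hx).mp h.superset)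

lemma card_simplexOf {x : List (Finset ℕ) × Finset ℕ} (hx : IsConfig r.supp r.rounds x) :
    (simplexOf r x).card = (r.supp \ x.2).card := by
  obtain ⟨σ, hσ, rfl⟩ := exists_mem_simplexIndices hx
  rw [simplexOf_encode hσ, card_vertices, active, hσ.2.1]
  rfl

lemma boundaryPart_eq (r : RoundCounter) (F : Finset ℕ) : boundaryPart r F =
    simplexOf r '' {x | IsConfig r.supp r.rounds x ∧ F ⊆ initialGhosts x} := by
  ext s
  constructor
  · rintro ⟨σ, ⟨hσ, hF⟩, rfl⟩
    exact ⟨σ.encode, ⟨(mem_simplexIndices.mp hσ).2, initialGhosts_encode.symm ▸ hF⟩,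
      simplexOf_encode hσ⟩
  · rintro ⟨x, ⟨hx, hF⟩, rfl⟩
    obtain ⟨σ, hσ, rfl⟩ := exists_mem_simplexIndices hx
    exact ⟨σ, ⟨hσ, initialGhosts_encode ▸ hF⟩, (simplexOf_encode hσ).symm⟩

lemma complex_eq_boundaryPart (r : RoundCounter) : complex r = boundaryPart r ∅ := by
  simp [complex, boundaryPart]

lemma complex_eq (r : RoundCounter) :
    complex r = simplexOf r '' {x | IsConfig r.supp r.rounds x} := by
  rw [complex_eq_boundaryPart, boundaryPart_eq]; simp

lemma isLowerSet_boundaryPart (r : RoundCounter) (F : Finset ℕ) :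
    IsLowerSet (boundaryPart r F) := by
  rw [boundaryPart_eq]
  rintro _ s hs ⟨x, ⟨hx, hF⟩, rfl⟩
  have hsK : s ∈ complex r := isLowerSet_complex r hs (complex_eq r ▸ ⟨x, hx, rfl⟩)
  rw [complex_eq] at hsK
  obtain ⟨y, hy, rfl⟩ := hsK
  exact ⟨y, ⟨hy, hF.trans ((simplexOf_subset_iff hy hx).mp hs).initialGhosts_subset⟩, rfl⟩

lemma boundary_boundaryPart {F : Finset ℕ} (hF : F ⊆ r.supp) : boundary (boundaryPart r F) =
    simplexOf r ''
      {x | IsConfig r.supp r.rounds x ∧ F ⊆ initialGhosts x ∧ initialGhosts x ≠ F} := by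
  have := isLowerSet_boundaryPart r F
  rw [boundaryPart_eq] at this ⊢
  exact boundary_image_configs _ (fun x hx y hy => simplexOf_subset_iff hx hy)
    (fun x hx => card_simplexOf hx) hF this

lemma collapsesTo_of_erasable {Q : Set (List (Finset ℕ) × Finset ℕ)} (hQ : Erasable FaceLE Q)
    (hQc : ∀ x ∈ Q, IsConfig r.supp r.rounds x)
    (hup : ∀ x ∈ Q, ∀ y, IsConfig r.supp r.rounds y → FaceLE x y → y ∈ Q) :
    CollapsesTo (complex r) (complex r \ simplexOf r '' Q) := by
  refine (hQ.image (simplexOf r) (simplexOf_injOn.mono hQc) fun x hx y hy =>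
    (simplexOf_subset_iff (hQc x hx) (hQc y hy)).symm).collapsesTo ?_ ?_
  · rw [complex_eq]
    exact Set.image_mono hQc
  · rintro _ ⟨x, hx, rfl⟩ ρ hρ hs
    rw [complex_eq] at hρ
    obtain ⟨y, hy, rfl⟩ := hρ
    exact ⟨y, hup x hx y hy ((simplexOf_subset_iff (hQc x hx) hy).mp hs), rfl⟩

theorem collapsible_complex (hr : r.supp.Nonempty) : Collapsible (complex r) := by
  obtain ⟨p, hp⟩ := hr
  refine ⟨complex_eq r ▸ (finite_configs _ _).image _, ?_⟩
  -- All blocks together, over every value `V` of the initial ghosts other than `p`.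
  have h : Erasable FaceLE {x | IsConfig r.supp r.rounds x} :=
    Erasable.of_antitone (finite_configs _ _) (fun x => initialGhosts x \ {p})
      (fun x _ y _ h => Finset.sdiff_subset_sdiff h.initialGhosts_subset le_rfl)
      fun V => erasable_configs hp V
  have := collapsesTo_of_erasable h (fun _ hx => hx) fun _ _ _ hy _ => hy
  rwa [← complex_eq, Set.sdiff_self] at this

theorem complex_collapsesTo {p : ℕ} (hp : p ∈ r.supp) :
    CollapsesTo (complex r) (boundary (complex r) \ interior (boundaryPart r {p})) := by
  -- The block `V = ∅` consists of the simplices with `G 0 ⊆ {p}`, a condition inherited by cofaces.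
  have h := collapsesTo_of_erasable (erasable_configs (r := r.rounds) hp ∅) (fun _ hx => hx.1)
    fun x hx y hy hle => ⟨hy, Finset.subset_empty.mp
      (hx.2 ▸ Finset.sdiff_subset_sdiff hle.initialGhosts_subset le_rfl)⟩
  convert h using 1
  have hpU : {p} ⊆ r.supp := by simpa using hp
  rw [interior, boundary_boundaryPart hpU, boundaryPart_eq, complex_eq_boundaryPart,
    boundary_boundaryPart (Finset.empty_subset _), boundaryPart_eq]
  have himage : ∀ A B : Set (List (Finset ℕ) × Finset ℕ),
      A ⊆ {x | IsConfig r.supp r.rounds x} → B ⊆ {x | IsConfig r.supp r.rounds x} →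
      simplexOf r '' A \ simplexOf r '' B = simplexOf r '' (A \ B) := by
    intro A B hA hB
    ext s
    constructor
    · rintro ⟨⟨x, hx, rfl⟩, h⟩
      exact ⟨x, ⟨hx, fun hxB => h ⟨x, hxB, rfl⟩⟩, rfl⟩
    · rintro ⟨x, ⟨hx, hxB⟩, rfl⟩
      refine ⟨⟨x, hx, rfl⟩, ?_⟩
      rintro ⟨y, hy, he⟩
      exact hxB (simplexOf_injOn (hB hy) (hA hx) he ▸ hy)
  rw [himage _ _ (fun x hx => hx.1) (fun x hx => hx.1),
    himage _ _ (fun x hx => hx.1) (fun x hx => hx.1.1),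
    himage _ _ (fun x hx => hx.1) (fun x hx => hx.1)]
  congr 1
  ext x
  -- What remains is logic: not `G 0 ⊆ {p}` is equivalent to `G 0 ≠ ∅` and `G 0 ≠ {p}`.
  have hx : initialGhosts x = {p} → p ∈ initialGhosts x := fun h => by simp [h]
  simp only [Set.mem_sdiff, Set.mem_ofPred_eq, Finset.empty_subset, true_and, and_true,
    Finset.singleton_subset_iff, Finset.sdiff_eq_empty_iff_subset, Finset.subset_singleton_iff]
  tauto

end ImmediateSnapshot

theorem mainTheorem2 (r : ImmediateSnapshot.RoundCounter) :
    -- `P(r)` is a well-defined simplicial complex whose simplices are indexed by the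
    -- witness structures, the one indexed by `σ` having dimension `|A(σ)| - 1`
    (IsLowerSet (ImmediateSnapshot.complex r) ∧
      Set.InjOn ImmediateSnapshot.WitnessPrestructure.vertices
        (ImmediateSnapshot.simplexIndices r) ∧
      ∀ σ ∈ ImmediateSnapshot.simplexIndices r, σ.vertices.card = σ.active.card) ∧
    -- `P(r)` is collapsible
    (r.supp.Nonempty → ImmediateSnapshot.Collapsible (ImmediateSnapshot.complex r)) ∧
    -- `P(r)` collapses to `∂P(r) \ int B_p(r)`
    (∀ p ∈ r.supp,
      ImmediateSnapshot.CollapsesTo (ImmediateSnapshot.complex r)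
        (ImmediateSnapshot.boundary (ImmediateSnapshot.complex r) \
          ImmediateSnapshot.interior (ImmediateSnapshot.boundaryPart r {p}))) := by
  refine ⟨⟨ImmediateSnapshot.isLowerSet_complex r, fun σ hσ τ hτ h => ?_,
    fun σ _ => ImmediateSnapshot.card_vertices σ⟩, ImmediateSnapshot.collapsible_complex,
    fun p => ImmediateSnapshot.complex_collapsesTo⟩
  obtain ⟨hσ', hσc⟩ := ImmediateSnapshot.mem_simplexIndices.mp hσ
  obtain ⟨hτ', hτc⟩ := ImmediateSnapshot.mem_simplexIndices.mp hτ
  rw [← ImmediateSnapshot.simplexOf_encode hσ, ← ImmediateSnapshot.simplexOf_encode hτ] at h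
  exact ImmediateSnapshot.WitnessPrestructure.encode_inj (hσ'.trans hτ'.symm)
    (ImmediateSnapshot.simplexOf_injOn hσc hτc h)
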